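/- All graphs are finite, simple and undirected; $\log$ is the natural logarithm. For $\alpha\ge 0$, a graph $G=(V,E)$ is \emph{$\alpha$-preserved} in a metric space $(X,\rho)$ if there are a map $x:V\to X$ and a number $r>0$ such that for all distinct $u,v\in V$: $\rho(x_u,x_v)<r$ if $u\sim v$, and $\rho(x_u,x_v)\ge\alpha r$ if $u\not\sim v$. The doubling dimension $\dim(X)$ is the smallest integer $d\ge 0$ such that every open ball of radius $s>0$ in $X$ is covered by at most $2^d$ open balls of radius $s/2$. Let $\dim_\alpha(G,\ell_2)$ be the minimum of $\dim(\ell_2^d)$ over the $d\in\{0,1,2,\dots\}$ for which $G$ is $\alpha$-preserved in $\ell_2^d=(\mathbb R^d,\|\cdot\|_2)$; an upper bound on $\dim_\alpha(G,\ell_2)$ includes the assertion that such a $d$ exists. Let $|P(G)|$ be the smallest number of parts in a partition of $V$ into cliques of $G$. Let $C(G)$ be the partition of $V$ in which $u,u'$ lie in the same part if and only if $N(u)=N(u')$, where $N(u)=\{v: v\sim u \text{ or } v=u\}$. Let $G/C(G)$ be the simple graph obtained by contracting each part of $C(G)$ to a vertex (distinct parts are adjacent iff some edge of $G$ joins them),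 and let $\lambda_G$ be the maximum eigenvalue of its adjacency matrix. \textbf{Proposition.} For every graph $G$ the following hold. \begin{enumerate} \item[(i)] If $0<\alpha<\frac1{\sqrt2}$, then $\dim_\alpha(G,\ell_2)\le\Big\lceil \log_2(5)\Big\lceil\frac{4\log(|P(G)|+1)}{2-4\alpha^2}\Big\rceil\Big\rceil$. \item[(ii)] If $\frac1{\sqrt3}<\alpha<1$, then $\dim_\alpha(G,\ell_2)\le\Big\lceil \log_2(5)\Big\lceil 12\Big(\frac{1+\alpha^2}{1-\alpha^2}\Big)^2\log|P(G)|\Big\rceil\Big\rceil$. \item[(iii)] If $\lambda_G>0$ and $1\le\alpha<\Big(1-\frac1{4\lambda_G}\Big)^{-1/2}$, then $\dim_\alpha(G,\ell_2)\le\Big\lceil \log_2(5)\cdot\min\big(\lceil192\,\lambda_G^2\log|C(G)|\rceil,\ |C(G)|-1\big)\Big\rceil$. \end{enumerate} (In (ii), $\log|P(G)|$ is read as $0$ for the graph without vertices.) Moreover, for every $n\ge4$ there is a graph $G$ on $n$ vertices with $\lambda_G>1$ which, for every $\alpha>\big(1-\frac1{\lambda_G}\big)^{-1/2}$, cannot be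 $\alpha$-preserved in $\ell_2$ (neither in any $\ell_2^d$ nor in the sequence space $\ell_2$). One may take $G$ to be the complete bipartite graph with both parts of size $\lfloor n/2\rfloor$, together with one isolated vertex if $n$ is odd. -/

import Mathlib

/-- Every open ball of radius `r > 0` is covered by at most `2 ^ d` open balls of radius `r / 2`. -/
def IsDoublingBound (X : Type*) [MetricSpace X] (d : ℕ) : Prop :=
  ∀ (x : X) (r : ℝ), 0 < r →
    ∃ t : Finset X, t.card ≤ 2 ^ d ∧ Metric.ball x r ⊆ ⋃ y ∈ t, Metric.ball y (r / 2)

/-- The doubling dimension of `X`: the least `d` with `IsDoublingBound X d`, and `⊤` if there is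
no such `d`. -/
noncomputable def doublingDim (X : Type*) [MetricSpace X] : ℕ∞ :=
  sInf {e : ℕ∞ | ∃ d : ℕ, IsDoublingBound X d ∧ e = (d : ℕ∞)}

/-- The data visualization algorithm `f` (a map sending each graph on `V` to a placement of its
vertices in `X`) `α`-preserves the graph `G`, for some neighborhood threshold `r > 0`. -/
def AlphaPreserves {V X : Type*} [MetricSpace X] (α : ℝ) (f : SimpleGraph V → V → X)
    (G : SimpleGraph V) : Prop :=
  ∃ r : ℝ, 0 < r ∧ ∀ u v : V, u ≠ v →
    (G.Adj u v → dist (f G u) (f G v) < r) ∧ (¬ G.Adj u v → α * r ≤ dist (f G u) (f G v))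

/-- `G` can be `α`-preserved in the metric space `X`. -/
def IsPreservableIn {V : Type*} (α : ℝ) (G : SimpleGraph V) (X : Type*) [MetricSpace X] : Prop :=
  ∃ f : SimpleGraph V → V → X, AlphaPreserves α f G

/-- The `α`-preservation dimension of `G` in the collection of metric spaces `X i`: the least
doubling dimension of a member in which `G` can be `α`-preserved. The undefined case (no member
works, or none of finite doubling dimension) is recorded as `⊤`. -/
noncomputable def preservationDim {V ι : Type*} (α : ℝ) (G : SimpleGraph V)
    (X : ι → Type*) [∀ i, MetricSpace (X i)] : ℕ∞ :=
  sInf {e : ℕ∞ | ∃ i : ι, IsPreservableIn α G (X i) ∧ e = doublingDim (X i)}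

/-- The `α`-preservation dimension of `G` in `ℓ₂`, i.e. in the collection of the Euclidean spaces
`ℓ₂^d`, `d = 0, 1, 2, …`. -/
noncomputable def preservationDimL2 {V : Type*} (α : ℝ) (G : SimpleGraph V) : ℕ∞ :=
  preservationDim α G (fun d : ℕ => EuclideanSpace ℝ (Fin d))

/-- `|P(G)|`: the smallest number of parts in a partition of the vertex set into cliques of `G`. -/
noncomputable def cliquePartitionCard {V : Type*} (G : SimpleGraph V) : ℕ :=
  sInf {k : ℕ | ∃ P : Set (Set V),
    Setoid.IsPartition P ∧ (∀ S ∈ P, G.IsClique S) ∧ P.ncard = k}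

/-- The closed neighborhood `N(u) = {v | v ∼ u or v = u}`. -/
def closedNeighborhood {V : Type*} (G : SimpleGraph V) (u : V) : Set V :=
  {v : V | G.Adj v u ∨ v = u}

/-- Two vertices are equivalent when they have the same closed neighborhood. -/
def nbhdSetoid {V : Type*} (G : SimpleGraph V) : Setoid V :=
  Setoid.ker (closedNeighborhood G)

/-- The parts of the neighborhood partition `C(G)`. -/
abbrev NbhdPartition {V : Type*} (G : SimpleGraph V) : Type _ :=
  Quotient (nbhdSetoid G)

/-- The simple graph `G / C(G)`, obtained by contracting each part of `C(G)`. -/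
def nbhdQuotient {V : Type*} (G : SimpleGraph V) : SimpleGraph (NbhdPartition G) where
  Adj a b := a ≠ b ∧ ∃ u v : V,
    Quotient.mk (nbhdSetoid G) u = a ∧ Quotient.mk (nbhdSetoid G) v = b ∧ G.Adj u v
  symm := ⟨fun _ _ h => by
    obtain ⟨hne, u, v, hu, hv, huv⟩ := h
    exact ⟨hne.symm, v, u, hv, hu, huv.symm⟩⟩
  loopless := ⟨fun _ h => h.1 rfl⟩

open Classical in
/-- The maximum eigenvalue of the adjacency matrix of a finite graph. -/
noncomputable def maxAdjEigenvalue {W : Type*} [Fintype W] (H : SimpleGraph W) : ℝ :=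
  sSup {μ : ℝ | Module.End.HasEigenvalue (Matrix.toLin' (H.adjMatrix ℝ)) μ}

open Classical in
/-- `λ_G`: the maximum eigenvalue of the adjacency matrix of `G / C(G)`. -/
noncomputable def lambdaG {V : Type*} [Fintype V] (G : SimpleGraph V) : ℝ :=
  maxAdjEigenvalue (nbhdQuotient G)

/-!
The upper bounds place `G` in a Euclidean space `ℓ₂ⁿ` and then bound the doubling dimension of
`ℓ₂ⁿ`; the volumetric estimate `5 ^ n` for the number of half-radius balls covering a ball
(`isDoublingBound_of_five_pow_le`) turns dimension `n` into `⌈n log₂ 5⌉`.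

For `α < 1` the parts of an optimal clique partition are collapsed to points, so that it is enough
to find `|P(G)|` points whose mutual distances lie in an interval `[α r, r)`
(`isPreservableIn_of_nearly_equidistant`). Sign vectors whose correlations are below
`ε = (1 - α²) / (1 + α²)` in absolute value have this property, and a greedy choice together with
Hoeffding's inequality yields about `exp (ε² n / 2)` of them (`exists_sign_code`). This gives
the bound with `log |P(G)|` (`preservationDimL2_le_of_lt_one`).

For `α < 1 / √2` the required dimension `d = ⌈2 log (|P(G)| + 1) / (1 - 2α²)⌉` is too small for such
a code when `α²` is in a middle range, so the argument uses that `5 ^ d` overestimates the covering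
number. A ball of radius `ρ` centred at `x`, `‖x‖ ≤ 1`, has half of its volume inside the ball of
radius `√(1 + ρ²)` around the origin, because `‖x + y‖² ≤ 1 + ρ²` as soon as `⟪x, y⟫ ≤ 0`. Hence a
greedy choice of centres in that ball covers the unit ball of `ℓ₂ⁿ` by roughly `5 ^ (n / 2)` balls of
radius `1 / 2`, up to a factor linear in `n` (`isDoublingBound_of_random_cover`). So the code may
live in dimension `n = ⌊13 d / 8⌋ > d` without exceeding the budget `5 ^ d`, once `d ≥ 25`. For
`d ≤ 24` the indicator vectors of the `w`-element subsets of a `(d + 1)`-element set serve as the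
points, with `w` depending on `α` and `d` (`exists_choose_ge`).

For `α ≥ 1`, vertices of the same class of `C(G)` are adjacent and share a point, so `G / C(G)` is to
be placed. Its adjacency matrix `A` has nonnegative entries, hence no eigenvalue below `-λ`, and
`1 + λ⁻¹ A` is the Gram matrix of vectors with squared distances `2 - 2 / λ` (adjacent) and `2`
(nonadjacent) (`exists_dist_sq_eq`). These vectors span an affine space of dimension at most
`|C(G)| - 1`; alternatively a random sign projection to `192 λ² log |C(G)|` coordinates keeps the two
kinds of pairs apart (`isPreservableIn_of_log_card_le`).

For the complete bipartite graph with parts of size `m` one has `λ = m`, and the inequality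
`∑ ‖x u - x u'‖² + ∑ ‖x v - x v'‖² ≤ 2 ∑ ‖x u - x v‖²` for two families of `m` points of an inner
product space (`sum_dist_sq_within_le`) forces `α² (m - 1) ≤ m`.
-/

open MeasureTheory Metric Module

/-! ### Covering numbers of Euclidean balls -/

theorem card_le_of_separated_ball {E : Type*} [NormedAddCommGroup E] [NormedSpace ℝ E]
    [FiniteDimensional ℝ E] {η : ℝ} (hη : 0 < η) (s : Finset E) (hs : ∀ c ∈ s, ‖c‖ ≤ 1)
    (h : ∀ c ∈ s, ∀ d ∈ s, c ≠ d → η ≤ dist c d) :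
    (s.card : ℝ) ≤ (1 + 2 / η) ^ finrank ℝ E := by
  borelize E
  let μ : Measure E := Measure.addHaar
  have hη2 : 0 < η / 2 := by positivity
  have hη3 : 0 < 1 + η / 2 := by positivity
  have hdisj : Set.Pairwise (s : Set E) (Function.onFun Disjoint fun c => ball c (η / 2)) := by
    intro c hc d hd hcd
    exact ball_disjoint_ball (by linarith [h c hc d hd hcd])
  have hsub : ⋃ c ∈ s, ball c (η / 2) ⊆ ball (0 : E) (1 + η / 2) := by
    refine Set.iUnion₂_subset fun x hx => ball_subset_ball' ?_
    rw [dist_zero_right]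
    linarith [hs x hx]
  have hI : (s.card : ENNReal) * ENNReal.ofReal ((η / 2) ^ finrank ℝ E) * μ (ball 0 1) ≤
      ENNReal.ofReal ((1 + η / 2) ^ finrank ℝ E) * μ (ball 0 1) := by
    calc _ = μ (⋃ c ∈ s, ball c (η / 2)) := by
          rw [measure_biUnion_finset hdisj fun c _ => measurableSet_ball]
          simp only [μ.addHaar_ball_of_pos _ hη2, Finset.sum_const, nsmul_eq_mul, mul_assoc]
      _ ≤ μ (ball (0 : E) (1 + η / 2)) := measure_mono hsub
      _ = _ := by simp only [μ.addHaar_ball_of_pos _ hη3]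
  have hJ := (ENNReal.mul_le_mul_iff_left (measure_ball_pos μ _ zero_lt_one).ne'
    measure_ball_lt_top.ne).1 hI
  have hK := ENNReal.toReal_le_of_le_ofReal (by positivity) hJ
  rw [ENNReal.toReal_mul, ENNReal.toReal_natCast, ENNReal.toReal_ofReal (by positivity)] at hK
  have : (1 + 2 / η) = (1 + η / 2) / (η / 2) := by field_simp; ring
  rw [this, div_pow, le_div_iff₀ (by positivity)]
  exact hK

/-- A separated set of maximal cardinality is a net. -/
theorem exists_net_ball (E : Type*) [NormedAddCommGroup E] [NormedSpace ℝ E]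
    [FiniteDimensional ℝ E] {η : ℝ} (hη : 0 < η) :
    ∃ s : Finset E, (s.card : ℝ) ≤ (1 + 2 / η) ^ finrank ℝ E ∧ (∀ c ∈ s, ‖c‖ ≤ 1) ∧
      ∀ z : E, ‖z‖ ≤ 1 → ∃ c ∈ s, dist z c < η := by
  classical
  let S : Set ℕ := {k | ∃ s : Finset E, (∀ c ∈ s, ‖c‖ ≤ 1) ∧
    (∀ c ∈ s, ∀ d ∈ s, c ≠ d → η ≤ dist c d) ∧ s.card = k}
  have hne : S.Nonempty := ⟨0, ∅, by simp, by simp, rfl⟩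
  have hbdd : BddAbove S := by
    refine ⟨⌊(1 + 2 / η) ^ finrank ℝ E⌋₊, ?_⟩
    rintro _ ⟨s, h1, h2, rfl⟩
    exact Nat.le_floor (card_le_of_separated_ball hη s h1 h2)
  obtain ⟨s, h1, h2, h3⟩ := Nat.sSup_mem hne hbdd
  refine ⟨s, card_le_of_separated_ball hη s h1 h2, h1, fun z hz => ?_⟩
  by_contra! hcon
  have hzs : z ∉ s := fun hzs => by
    have := hcon z hzs
    rw [dist_self] at this
    linarith
  have hmem : (insert z s).card ∈ S := by
    refine ⟨insert z s, ?_, ?_, rfl⟩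
    · simpa [hz] using h1
    · intro c hc d hd hcd
      rw [Finset.mem_insert] at hc hd
      rcases hc with rfl | hc <;> rcases hd with rfl | hd
      · exact absurd rfl hcd
      · exact hcon d hd
      · rw [dist_comm]; exact hcon c hc
      · exact h2 c hc d hd hcd
  have := le_csSup hbdd hmem
  rw [Finset.card_insert_of_notMem hzs, h3] at this
  omega

/-- Coverings of the unit ball by half-radius balls transfer to all balls by an affine map. -/
theorem isDoublingBound_of_cover_unit_ball {E : Type*} [NormedAddCommGroup E] [NormedSpace ℝ E]
    {D : ℕ} (t : Finset E) (ht : t.card ≤ 2 ^ D)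
    (hcov : ∀ z : E, ‖z‖ ≤ 1 → ∃ c ∈ t, dist z c < 1 / 2) : IsDoublingBound E D := by
  classical
  intro x r hr
  refine ⟨t.image fun c => x + r • c, Finset.card_image_le.trans ht, fun y hy => ?_⟩
  have hz : ‖r⁻¹ • (y - x)‖ ≤ 1 := by
    rw [mem_ball, dist_eq_norm] at hy
    rw [norm_smul, norm_inv, Real.norm_of_nonneg hr.le, inv_mul_le_iff₀ hr]
    linarith
  obtain ⟨c, hc, hzc⟩ := hcov _ hz
  refine Set.mem_iUnion₂.2 ⟨x + r • c, Finset.mem_image_of_mem _ hc, ?_⟩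
  have : y - (x + r • c) = r • (r⁻¹ • (y - x) - c) := by
    rw [smul_sub, smul_inv_smul₀ hr.ne']; abel
  rw [mem_ball, dist_eq_norm, this, norm_smul, Real.norm_of_nonneg hr.le, ← dist_eq_norm]
  nlinarith

theorem isDoublingBound_of_five_pow_le {n D : ℕ} (h : 5 ^ n ≤ 2 ^ D) :
    IsDoublingBound (EuclideanSpace ℝ (Fin n)) D := by
  obtain ⟨t, h1, -, h3⟩ := exists_net_ball (EuclideanSpace ℝ (Fin n)) (η := 1 / 2) (by norm_num)
  refine isDoublingBound_of_cover_unit_ball t ?_ h3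
  rw [finrank_euclideanSpace_fin] at h1
  norm_num at h1
  exact le_trans (by exact_mod_cast h1) h

section Greedy
variable {E : Type*} [NormedAddCommGroup E] [InnerProductSpace ℝ E]

/-- A half of `ball x ρ` (the half pointing away from `x`) stays in the ball of radius
`√(‖x‖ ^ 2 + ρ ^ 2)` around the origin. -/
theorem half_measure_ball_le [MeasurableSpace E] [BorelSpace E] [FiniteDimensional ℝ E]
    (μ : Measure E) [μ.IsAddHaarMeasure] {x : E} (hx : ‖x‖ ≤ 1) {ρ : ℝ} (hρ : 0 < ρ) :
    μ.real (ball 0 ρ) / 2 ≤ μ.real (ball x ρ ∩ ball 0 √(1 + ρ ^ 2)) := by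
  let A : Set E := ball 0 ρ ∩ {y | inner ℝ x y ≤ 0}
  have hAfin : ∀ s ⊆ ball (0 : E) ρ, μ s ≠ ⊤ := fun s hs =>
    ((measure_mono hs).trans_lt measure_ball_lt_top).ne
  have h1 : μ.real (ball 0 ρ) ≤ μ.real A + μ.real (-A) := by
    refine (measureReal_mono ?_ ?_).trans (measureReal_union_le _ _)
    · intro y hy
      rcases le_total (inner ℝ x y) 0 with h | h
      · exact Or.inl ⟨hy, h⟩
      · right
        refine ⟨by simpa using hy, ?_⟩
        simpa using h
    · refine hAfin _ (Set.union_subset Set.inter_subset_left ?_)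
      intro y hy
      simpa using hy.1
  have h2 : μ.real (-A) = μ.real A := by
    rw [measureReal_def, measureReal_def, Measure.measure_neg]
  have h3 : μ.real A = μ.real ((fun y => x + y) '' A) := by
    rw [measureReal_def, measureReal_def, Set.image_add_left, measure_preimage_add]
  have h4 : μ.real ((fun y => x + y) '' A) ≤ μ.real (ball x ρ ∩ ball 0 √(1 + ρ ^ 2)) := by
    refine measureReal_mono ?_ ?_
    · rintro _ ⟨y, ⟨hy, hxy⟩, rfl⟩
      rw [mem_ball_zero_iff] at hy
      refine ⟨by simpa [mem_ball, dist_eq_norm] using hy, ?_⟩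
      rw [mem_ball_zero_iff]
      apply Real.lt_sqrt_of_sq_lt
      have h5 := norm_add_sq_real x y
      have h6 : inner ℝ x y ≤ 0 := hxy
      have := norm_nonneg x
      have := norm_nonneg y
      nlinarith
    · exact ((measure_mono Set.inter_subset_left).trans_lt measure_ball_lt_top).ne
  linarith

/-- Averaging over centres distributed uniformly in a ball of radius `√(1 + ρ ^ 2)`: some ball of
radius `ρ` captures a large proportion of any finite set of points of the unit ball. -/
theorem exists_center_capturing [FiniteDimensional ℝ E] {ρ : ℝ} (hρ : 0 < ρ) (X : Finset E)
    (hX : ∀ x ∈ X, ‖x‖ ≤ 1) :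
    ∃ c : E, (ρ / √(1 + ρ ^ 2)) ^ finrank ℝ E / 2 * X.card ≤
      ((X.filter fun x => dist x c < ρ).card : ℝ) := by
  classical
  borelize E
  let μ : Measure E := Measure.addHaar
  have hR : 0 < √(1 + ρ ^ 2) := by positivity
  set T : Set E := ball 0 √(1 + ρ ^ 2) with hT
  have hT0 : μ T ≠ 0 := (measure_ball_pos μ _ hR).ne'
  have hT1 : μ T ≠ ⊤ := measure_ball_lt_top.ne
  have hTpos : 0 < μ.real T := ENNReal.toReal_pos hT0 hT1
  let f : E → ℝ := fun c => ∑ x ∈ X, (ball x ρ).indicator (fun _ => (1 : ℝ)) c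
  have hint : ∀ x ∈ X, IntegrableOn ((ball x ρ).indicator (fun _ => (1 : ℝ))) T μ := fun x _ =>
    (integrableOn_const hT1).indicator measurableSet_ball
  have hf : IntegrableOn f T μ := integrable_finsetSum _ hint
  obtain ⟨c, -, hc⟩ := exists_setAverage_le hT0 hT1 hf
  refine ⟨c, ?_⟩
  have h1 : f c = ((X.filter fun x => dist x c < ρ).card : ℝ) := by
    simp only [f, Finset.card_filter, Nat.cast_sum, Set.indicator_apply, mem_ball, dist_comm c]
    push_cast
    rfl
  rw [← h1]
  refine le_trans ?_ hc
  rw [setAverage_eq, smul_eq_mul, inv_mul_eq_div, le_div_iff₀ hTpos,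
    integral_finsetSum _ hint]
  have h2 : ∀ x ∈ X, (ρ / √(1 + ρ ^ 2)) ^ finrank ℝ E / 2 * μ.real T ≤
      ∫ y in T, (ball x ρ).indicator (fun _ => (1 : ℝ)) y ∂μ := by
    intro x hx
    rw [setIntegral_indicator measurableSet_ball, setIntegral_const, smul_eq_mul, mul_one,
      Set.inter_comm]
    refine le_trans (le_of_eq ?_) (half_measure_ball_le μ (hX x hx) hρ)
    rw [hT, measureReal_def, measureReal_def, μ.addHaar_ball_of_pos _ hR,
      μ.addHaar_ball_of_pos _ hρ, ENNReal.toReal_mul, ENNReal.toReal_mul,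
      ENNReal.toReal_ofReal (by positivity), ENNReal.toReal_ofReal (by positivity), div_pow]
    field_simp
  calc _ = ∑ x ∈ X, (ρ / √(1 + ρ ^ 2)) ^ finrank ℝ E / 2 * μ.real T := by
        rw [Finset.sum_const, nsmul_eq_mul]; ring
    _ ≤ _ := Finset.sum_le_sum h2

/-- Iterating `exists_center_capturing` on the points not yet captured. -/
theorem exists_centers_capturing [FiniteDimensional ℝ E] {ρ : ℝ} (hρ : 0 < ρ) (X : Finset E)
    (hX : ∀ x ∈ X, ‖x‖ ≤ 1) (k : ℕ) :
    ∃ t : Finset E, t.card ≤ k ∧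
      ((X.filter fun x => ∀ c ∈ t, ρ ≤ dist x c).card : ℝ) ≤
        (1 - (ρ / √(1 + ρ ^ 2)) ^ finrank ℝ E / 2) ^ k * X.card := by
  classical
  set q : ℝ := (ρ / √(1 + ρ ^ 2)) ^ finrank ℝ E / 2 with hq
  have hq1 : 0 ≤ 1 - q := by
    have : (ρ / √(1 + ρ ^ 2)) ^ finrank ℝ E ≤ 1 := by
      refine pow_le_one₀ (by positivity) ((div_le_one (by positivity)).2 ?_)
      exact Real.le_sqrt_of_sq_le (by linarith)
    linarith
  induction k with
  | zero => exact ⟨∅, by simp, by simp⟩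
  | succ k ih =>
    obtain ⟨t, ht, htX⟩ := ih
    set Y := X.filter fun x => ∀ c ∈ t, ρ ≤ dist x c with hY
    obtain ⟨c, hc⟩ := exists_center_capturing hρ Y fun x hx => hX x (Finset.mem_filter.1 hx).1
    rw [← hq] at hc
    refine ⟨insert c t, (Finset.card_insert_le _ _).trans (by omega), ?_⟩
    have h1 : (X.filter fun x => ∀ e ∈ insert c t, ρ ≤ dist x e) =
        Y.filter fun x => ¬ dist x c < ρ := by
      ext x
      simp only [hY, Finset.mem_filter, Finset.mem_insert, forall_eq_or_imp, not_lt]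
      tauto
    have h2 := Finset.card_filter_add_card_filter_not (s := Y) (fun x => dist x c < ρ)
    have h3 : ((Y.filter fun x => dist x c < ρ).card : ℝ) +
        ((Y.filter fun x => ¬ dist x c < ρ).card : ℝ) = Y.card := by exact_mod_cast h2
    rw [h1]
    calc ((Y.filter fun x => ¬ dist x c < ρ).card : ℝ) ≤ (1 - q) * Y.card := by linarith
      _ ≤ (1 - q) * ((1 - q) ^ k * X.card) := by gcongr
      _ = _ := by ring
end Greedy

/-- A doubling bound for `ℓ₂ⁿ` of order `(1 + ρ⁻²) ^ (n / 2)` with `ρ = 0.49`, up to a linear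
factor; for large `n` it is about the square root of the volumetric bound `5 ^ n`. -/
theorem isDoublingBound_of_random_cover {n D : ℕ}
    (h : 10.62 * (n : ℝ) * 2.2727 ^ n + 1 ≤ 2 ^ D) :
    IsDoublingBound (EuclideanSpace ℝ (Fin n)) D := by
  classical
  obtain ⟨X, hX1, hX2, hX3⟩ :=
    exists_net_ball (EuclideanSpace ℝ (Fin n)) (η := 1 / 100) (by norm_num)
  -- The unit ball is covered by the balls of radius `1 / 2` around a set of centres once every point
  -- of a net of mesh `0.01` is at distance less than `0.49` from some centre.
  -- Each centre captures a proportion `q` of the net points left over by the previous ones.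
  set q : ℝ := (0.49 / √(1 + 0.49 ^ 2)) ^ n / 2 with hq
  have hq0 : 0 < q := by positivity
  have hbase : (2.2727 : ℝ)⁻¹ ≤ 0.49 / √(1 + 0.49 ^ 2) := by
    have : √(1 + 0.49 ^ 2) ≤ 0.49 * 2.2727 := Real.sqrt_le_iff.2 ⟨by norm_num, by norm_num⟩
    rw [le_div_iff₀ (by positivity), inv_mul_le_iff₀ (by norm_num)]
    linarith
  have hqinv : q⁻¹ ≤ 2 * 2.2727 ^ n := by
    have h1 : (2 * 2.2727 ^ n : ℝ)⁻¹ ≤ q := by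
      rw [hq, mul_inv, ← inv_pow, div_eq_mul_inv, mul_comm]
      gcongr
    exact inv_le_of_inv_le₀ (by positivity) h1
  -- `5.31` exceeds `log 201`, and the net has at most `201 ^ n` points, so after `k` steps less
  -- than one net point is left.
  set k : ℕ := ⌊5.31 * n / q⌋₊ + 1 with hk
  obtain ⟨t, ht1, ht2⟩ := exists_centers_capturing (ρ := 0.49) (by norm_num) X hX2 k
  rw [finrank_euclideanSpace_fin] at hX1 ht2
  rw [← hq] at ht2
  have hexp : (201 : ℝ) ≤ Real.exp 5.31 := by
    have h1 : (2.718 : ℝ) ^ 5 ≤ Real.exp 1 ^ 5 := by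
      gcongr
      linarith [Real.exp_one_gt_d9]
    have h2 : (1 + 0.31 + 0.31 ^ 2 / 2 : ℝ) ≤ Real.exp 0.31 :=
      Real.quadratic_le_exp_of_nonneg (by norm_num)
    have h3 : Real.exp 5.31 = Real.exp 1 ^ 5 * Real.exp 0.31 := by
      rw [← Real.exp_nat_mul, ← Real.exp_add]; norm_num
    rw [h3]
    calc (201 : ℝ) ≤ 2.718 ^ 5 * (1 + 0.31 + 0.31 ^ 2 / 2) := by norm_num
      _ ≤ _ := by gcongr
  have hempty : (X.filter fun x => ∀ c ∈ t, 0.49 ≤ dist x c) = ∅ := by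
    rw [← Finset.card_eq_zero, ← Nat.lt_one_iff, ← Nat.cast_lt (α := ℝ), Nat.cast_one]
    have hqle : q ≤ 1 := by
      have : (0.49 / √(1 + 0.49 ^ 2) : ℝ) ^ n ≤ 1 := by
        refine pow_le_one₀ (by positivity) ((div_le_one (by positivity)).2 ?_)
        exact Real.le_sqrt_of_sq_le (by norm_num)
      linarith
    have hkq : 5.31 * n < q * k := by
      have := Nat.lt_floor_add_one (5.31 * n / q)
      rw [div_lt_iff₀ hq0] at this
      rw [hk]; push_cast; linarith
    calc _ ≤ (1 - q) ^ k * X.card := ht2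
      _ ≤ Real.exp (-q) ^ k * Real.exp 5.31 ^ n := by
        gcongr
        · exact Real.one_sub_le_exp_neg q
        · refine hX1.trans ?_
          norm_num at hexp ⊢
          gcongr
      _ = Real.exp (5.31 * n - q * k) := by
        rw [← Real.exp_nat_mul, ← Real.exp_nat_mul, ← Real.exp_add]; ring_nf
      _ < 1 := Real.exp_lt_one_iff.2 (by linarith)
  refine isDoublingBound_of_cover_unit_ball t ?_ fun z hz => ?_
  · have h1 : (k : ℝ) ≤ 5.31 * n / q + 1 := by
      rw [hk]; push_cast
      gcongr
      exact Nat.floor_le (by positivity)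
    have h2 : 5.31 * n / q ≤ 10.62 * (n : ℝ) * 2.2727 ^ n := by
      calc 5.31 * n / q = 5.31 * n * q⁻¹ := div_eq_mul_inv _ _
        _ ≤ 5.31 * n * (2 * 2.2727 ^ n) := by gcongr
        _ = _ := by ring
    have h3 : (k : ℝ) ≤ ((2 ^ D : ℕ) : ℝ) := by push_cast; linarith
    exact ht1.trans (by exact_mod_cast h3)
  · obtain ⟨x, hx, hzx⟩ := hX3 z hz
    have hx' : x ∉ X.filter fun x => ∀ c ∈ t, 0.49 ≤ dist x c := by rw [hempty]; simp
    simp only [Finset.mem_filter, not_and, not_forall, not_le] at hx'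
    obtain ⟨c, hc, hxc⟩ := hx' hx
    refine ⟨c, hc, (dist_triangle z x c).trans_lt ?_⟩
    norm_num at hxc hzx ⊢
    linarith

theorem preservationDimL2_le {V : Type*} {α : ℝ} {G : SimpleGraph V} {n D : ℕ}
    (hG : IsPreservableIn α G (EuclideanSpace ℝ (Fin n)))
    (hD : IsDoublingBound (EuclideanSpace ℝ (Fin n)) D) :
    preservationDimL2 α G ≤ (D : ℕ∞) := by
  have h1 : preservationDimL2 α G ≤ doublingDim (EuclideanSpace ℝ (Fin n)) := sInf_le ⟨n, hG, rfl⟩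
  have h2 : doublingDim (EuclideanSpace ℝ (Fin n)) ≤ D := sInf_le ⟨D, hD, rfl⟩
  exact h1.trans h2

theorem five_pow_le_two_pow_ceil {n : ℕ} {x : ℝ} (h : (n : ℝ) ≤ x) :
    (5 : ℝ) ^ n ≤ 2 ^ ⌈Real.logb 2 5 * x⌉₊ := by
  have hlog : 0 < Real.logb 2 5 := Real.logb_pos (by norm_num) (by norm_num)
  have h1 : Real.logb 2 5 * n ≤ (⌈Real.logb 2 5 * x⌉₊ : ℝ) :=
    (mul_le_mul_of_nonneg_left h hlog.le).trans (Nat.le_ceil _)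
  calc (5 : ℝ) ^ n = 2 ^ (Real.logb 2 5 * n) := by
        rw [Real.rpow_mul (by norm_num), Real.rpow_logb (by norm_num) (by norm_num) (by norm_num),
          Real.rpow_natCast]
    _ ≤ 2 ^ ((⌈Real.logb 2 5 * x⌉₊ : ℕ) : ℝ) :=
        Real.rpow_le_rpow_of_exponent_le (by norm_num) h1
    _ = _ := Real.rpow_natCast _ _

theorem preservationDimL2_le_ceil {V : Type*} {α : ℝ} {G : SimpleGraph V} {n : ℕ} {x : ℝ}
    (hG : IsPreservableIn α G (EuclideanSpace ℝ (Fin n))) (h : (n : ℝ) ≤ x) :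
    preservationDimL2 α G ≤ ((⌈Real.logb 2 5 * x⌉₊ : ℕ) : ℕ∞) :=
  preservationDimL2_le hG (isDoublingBound_of_five_pow_le
    (by exact_mod_cast five_pow_le_two_pow_ceil h))

/-! ### Placements from nearly equidistant points, and sign codes -/

/-- Preserving a single graph is a condition on one placement, as the algorithm may be constant. -/
theorem isPreservableIn_iff {V X : Type*} [MetricSpace X] {α : ℝ} {G : SimpleGraph V} :
    IsPreservableIn α G X ↔ ∃ (x : V → X) (r : ℝ), 0 < r ∧ ∀ u v : V, u ≠ v →
      (G.Adj u v → dist (x u) (x v) < r) ∧ (¬ G.Adj u v → α * r ≤ dist (x u) (x v)) :=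
  ⟨fun ⟨f, r, hr, h⟩ => ⟨f G, r, hr, h⟩, fun ⟨x, r, hr, h⟩ => ⟨fun _ => x, r, hr, h⟩⟩

theorem isPreservableIn_euclidean_finrank {V F : Type*} [NormedAddCommGroup F]
    [InnerProductSpace ℝ F] [FiniteDimensional ℝ F] {α : ℝ} {G : SimpleGraph V}
    (h : IsPreservableIn α G F) : IsPreservableIn α G (EuclideanSpace ℝ (Fin (finrank ℝ F))) := by
  rw [isPreservableIn_iff] at h ⊢
  obtain ⟨x, r, hr, h⟩ := h
  refine ⟨fun u => (stdOrthonormalBasis ℝ F).repr (x u), r, hr, fun u v huv => ?_⟩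
  rw [LinearIsometryEquiv.dist_map]
  exact h u v huv

/-- The infimum defining `cliquePartitionCard` is attained: the partition into singletons shows that
it is not taken over the empty set. -/
theorem exists_clique_partition {V : Type*} [Finite V] (G : SimpleGraph V) :
    ∃ P : Set (Set V), Setoid.IsPartition P ∧ (∀ S ∈ P, G.IsClique S) ∧
      P.ncard = cliquePartitionCard G := by
  have hne : {k : ℕ | ∃ P : Set (Set V),
      Setoid.IsPartition P ∧ (∀ S ∈ P, G.IsClique S) ∧ P.ncard = k}.Nonempty := by
    refine ⟨_, (⊥ : Setoid V).classes, Setoid.isPartition_classes _, ?_, rfl⟩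
    rintro _ ⟨y, rfl⟩ a ha b hb hab
    exact absurd ((show a = y from ha).trans (show b = y from hb).symm) hab
  exact Nat.sInf_mem hne

/-- As many nearly equidistant points as there are parts in an optimal clique partition suffice:
every clique is sent to a single point. -/
theorem isPreservableIn_of_nearly_equidistant {V X : Type*} [Finite V] [MetricSpace X] {α : ℝ}
    {G : SimpleGraph V} (T : Finset X) (hT : cliquePartitionCard G ≤ T.card) {A B : ℝ}
    (hB : 0 < B) (hAB : α ^ 2 * B ≤ A)
    (h : ∀ x ∈ T, ∀ y ∈ T, x ≠ y → A ≤ dist x y ^ 2 ∧ dist x y ^ 2 < B) :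
    IsPreservableIn α G X := by
  classical
  obtain ⟨P, hP, hclique, hcard⟩ := exists_clique_partition G
  have := Fintype.ofFinite P
  have hle : Fintype.card P ≤ Fintype.card T := by
    rw [Fintype.card_coe, ← Nat.card_eq_fintype_card, Nat.card_coe_set_eq, hcard]
    exact hT
  obtain ⟨e⟩ := Function.Embedding.nonempty_of_card_le hle
  choose cell hcell using fun u => (hP.2 u).exists
  rw [isPreservableIn_iff]
  refine ⟨fun u => (e ⟨cell u, (hcell u).1⟩ : X), √B, Real.sqrt_pos.2 hB, fun u v huv => ?_⟩
  by_cases hc : cell u = cell v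
  · have hadj : G.Adj u v :=
      hclique _ (hcell u).1 (hcell u).2 (by rw [hc]; exact (hcell v).2) huv
    refine ⟨fun _ => ?_, fun hn => absurd hadj hn⟩
    simp only [hc, dist_self]
    exact Real.sqrt_pos.2 hB
  · have hne : (e ⟨cell u, (hcell u).1⟩ : X) ≠ e ⟨cell v, (hcell v).1⟩ := fun heq =>
      hc (congrArg Subtype.val (e.injective (Subtype.ext heq)))
    obtain ⟨h1, h2⟩ := h _ (e _).2 _ (e _).2 hne
    refine ⟨fun _ => Real.lt_sqrt_of_sq_lt h2, fun _ => ?_⟩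
    refine abs_le_of_sq_le_sq' ?_ dist_nonneg |>.2
    rw [mul_pow, Real.sq_sqrt hB.le]
    exact hAB.trans h1

/-- The sign `±1` encoded by a Boolean. -/
def boolSign (b : Bool) : ℝ := if b then 1 else -1

theorem boolSign_not (b : Bool) : boolSign (!b) = -boolSign b := by
  cases b <;> simp [boolSign]

theorem boolSign_sq (b : Bool) : boolSign b ^ 2 = 1 := by
  cases b <;> simp [boolSign]

theorem sum_prod_eq_prod_sum {ι κ : Type*} [Fintype ι] [DecidableEq ι] [Fintype κ]
    (f : ι → κ → ℝ) : ∑ y : ι → κ, ∏ i, f i (y i) = ∏ i, ∑ b, f i b := by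
  rw [Finset.prod_univ_sum, Fintype.piFinset_univ]

theorem sum_exp_sign_correlation {n : ℕ} (x : Fin n → Bool) (t : ℝ) :
    ∑ y : Fin n → Bool, Real.exp (t * ∑ i, boolSign (x i) * boolSign (y i)) =
      (2 * Real.cosh t) ^ n := by
  have h1 : ∀ y : Fin n → Bool, Real.exp (t * ∑ i, boolSign (x i) * boolSign (y i)) =
      ∏ i, Real.exp (t * (boolSign (x i) * boolSign (y i))) := fun y => by
    rw [Finset.mul_sum, Real.exp_sum]
  rw [Finset.sum_congr rfl fun y _ => h1 y,
    sum_prod_eq_prod_sum fun i b => Real.exp (t * (boolSign (x i) * boolSign b))]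
  have h2 : ∀ i, ∑ b, Real.exp (t * (boolSign (x i) * boolSign b)) = 2 * Real.cosh t := by
    intro i
    rw [Fintype.sum_bool, Real.cosh_eq]
    cases x i <;> simp [boolSign] <;> ring
  rw [Finset.prod_congr rfl fun i _ => h2 i, Finset.prod_const, Finset.card_univ, Fintype.card_fin]

/-- Hoeffding's inequality for the correlation with a uniformly random sign vector. -/
theorem card_sign_correlation_ge {n : ℕ} (x : Fin n → Bool) {ε : ℝ} (hε : 0 ≤ ε) :
    ((Finset.univ.filter fun y : Fin n → Bool =>
      ε * n ≤ ∑ i, boolSign (x i) * boolSign (y i)).card : ℝ) ≤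
      2 ^ n * Real.exp (-(ε ^ 2 * n / 2)) := by
  set F := Finset.univ.filter fun y : Fin n → Bool =>
      ε * n ≤ ∑ i, boolSign (x i) * boolSign (y i) with hF
  have h1 : (F.card : ℝ) * Real.exp (ε * (ε * n)) ≤ (2 * Real.cosh ε) ^ n := by
    rw [← sum_exp_sign_correlation x ε, ← nsmul_eq_mul, ← Finset.sum_const]
    refine (Finset.sum_le_sum fun y hy => ?_).trans
      (Finset.sum_le_sum_of_subset_of_nonneg (Finset.subset_univ F) fun _ _ _ => (Real.exp_pos _).le)
    have := (Finset.mem_filter.1 hy).2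
    gcongr
  have h2 : (2 * Real.cosh ε) ^ n ≤ 2 ^ n * Real.exp (n * (ε ^ 2 / 2)) := by
    rw [mul_pow, Real.exp_nat_mul]
    gcongr
    exact Real.cosh_le_exp_half_sq ε
  rw [← le_div_iff₀ (Real.exp_pos _)] at h1
  refine h1.trans ((div_le_div_of_nonneg_right h2 (Real.exp_pos _).le).trans (le_of_eq ?_))
  rw [mul_div_assoc, ← Real.exp_sub]
  congr 2
  ring

theorem card_abs_sign_correlation_ge {n : ℕ} (x : Fin n → Bool) {ε : ℝ} (hε : 0 ≤ ε) :
    ((Finset.univ.filter fun y : Fin n → Bool =>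
      ε * n ≤ |∑ i, boolSign (x i) * boolSign (y i)|).card : ℝ) ≤
      2 * (2 ^ n * Real.exp (-(ε ^ 2 * n / 2))) := by
  classical
  have h1 := card_sign_correlation_ge x hε
  have h2 := card_sign_correlation_ge (fun i => !(x i)) hε
  simp only [boolSign_not, neg_mul, Finset.sum_neg_distrib] at h2
  have h3 : (Finset.univ.filter fun y : Fin n → Bool =>
      ε * n ≤ |∑ i, boolSign (x i) * boolSign (y i)|) ⊆
      (Finset.univ.filter fun y => ε * n ≤ ∑ i, boolSign (x i) * boolSign (y i)) ∪
      (Finset.univ.filter fun y => ε * n ≤ -∑ i, boolSign (x i) * boolSign (y i)) := by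
    intro y
    simp only [Finset.mem_filter, Finset.mem_univ, true_and, Finset.mem_union]
    exact le_abs.1
  have h4 := (Finset.card_le_card h3).trans (Finset.card_union_le _ _)
  have h5 := (Nat.cast_le (α := ℝ)).2 h4
  push_cast at h5
  linarith

/-- Greedy (Gilbert–Varshamov) selection of points that pairwise avoid a sparse relation. -/
theorem exists_finset_pairwise_not {Y : Type*} [Fintype Y] (bad : Y → Y → Prop)
    [DecidableRel bad] (hrefl : ∀ x, bad x x) (hsymm : ∀ x y, bad x y → bad y x) {B : ℝ}
    (hB : ∀ x, ((Finset.univ.filter fun y => bad x y).card : ℝ) ≤ B) (k : ℕ)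
    (hk : ((k : ℝ) - 1) * B < Fintype.card Y) (hY : 0 < Fintype.card Y) :
    ∃ T : Finset Y, T.card = k ∧ ∀ x ∈ T, ∀ y ∈ T, x ≠ y → ¬ bad x y := by
  classical
  induction k with
  | zero => exact ⟨∅, by simp, by simp⟩
  | succ k ih =>
    have hB0 : 0 ≤ B := by
      obtain ⟨x⟩ := Fintype.card_pos_iff.1 hY
      exact (Nat.cast_nonneg _).trans (hB x)
    push_cast at hk
    obtain ⟨T, hTk, hT⟩ := ih (by linarith)
    have h1 : ((T.biUnion fun x => Finset.univ.filter fun y => bad x y).card : ℝ) <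
        (Finset.univ : Finset Y).card := by
      calc _ ≤ ((∑ x ∈ T, (Finset.univ.filter fun y => bad x y).card : ℕ) : ℝ) := by
            exact_mod_cast Finset.card_biUnion_le
        _ ≤ ∑ x ∈ T, B := by push_cast; exact Finset.sum_le_sum fun x _ => hB x
        _ < _ := by rw [Finset.sum_const, nsmul_eq_mul, hTk, Finset.card_univ]; linarith
    obtain ⟨z, -, hz⟩ := Finset.exists_mem_notMem_of_card_lt_card (by exact_mod_cast h1)
    simp only [Finset.mem_biUnion, Finset.mem_filter, Finset.mem_univ, true_and, not_exists,
      not_and] at hz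
    have hzT : z ∉ T := fun h => hz z h (hrefl z)
    refine ⟨insert z T, by rw [Finset.card_insert_of_notMem hzT, hTk], ?_⟩
    intro x hx y hy hxy
    rw [Finset.mem_insert] at hx hy
    rcases hx with rfl | hx <;> rcases hy with rfl | hy
    · exact absurd rfl hxy
    · exact fun h => hz y hy (hsymm _ _ h)
    · exact hz x hx
    · exact hT x hx y hy hxy

/-- A random-like binary code: many sign vectors with pairwise correlations below `ε`. -/
theorem exists_sign_code {n k : ℕ} {ε : ℝ} (hε0 : 0 < ε) (hε1 : ε ≤ 1)
    (hk : ((k : ℝ) - 1) * (2 * Real.exp (-(ε ^ 2 * n / 2))) < 1) :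
    ∃ T : Finset (EuclideanSpace ℝ (Fin n)), T.card = k ∧ ∀ x ∈ T, ∀ y ∈ T, x ≠ y →
      2 * n * (1 - ε) < dist x y ^ 2 ∧ dist x y ^ 2 < 2 * n * (1 + ε) := by
  classical
  obtain ⟨T, hT1, hT2⟩ := exists_finset_pairwise_not
    (fun x y : Fin n → Bool => ε * n ≤ |∑ i, boolSign (x i) * boolSign (y i)|)
    (fun x => by
      simp only [← sq, boolSign_sq, Finset.sum_const, Finset.card_univ, Fintype.card_fin,
        nsmul_eq_mul, mul_one, Nat.abs_cast]
      exact mul_le_of_le_one_left n.cast_nonneg hε1)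
    (fun x y h => by simpa only [mul_comm] using h)
    (fun x => card_abs_sign_correlation_ge x hε0.le) k
    (by
      have h2 : (0 : ℝ) < 2 ^ n := by positivity
      rw [Fintype.card_fun, Fintype.card_bool, Fintype.card_fin]
      push_cast
      nlinarith)
    (Fintype.card_pos)
  let φ : (Fin n → Bool) → EuclideanSpace ℝ (Fin n) := fun y => WithLp.toLp 2 fun i => boolSign (y i)
  have hdist : ∀ x y, dist (φ x) (φ y) ^ 2 =
      2 * n - 2 * ∑ i, boolSign (x i) * boolSign (y i) := by
    intro x y
    rw [EuclideanSpace.dist_eq, Real.sq_sqrt (by positivity)]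
    simp only [φ, Real.dist_eq, sq_abs, sub_sq, boolSign_sq, Finset.sum_add_distrib,
      Finset.sum_sub_distrib, Finset.sum_const, Finset.card_univ, Fintype.card_fin, nsmul_eq_mul,
      mul_one, mul_assoc, ← Finset.mul_sum]
    ring
  have hφ : Function.Injective φ := by
    intro x y hxy
    funext i
    have := congrArg (fun z => z i) hxy
    simp only [φ, boolSign] at this
    revert this
    cases x i <;> cases y i <;> norm_num
  refine ⟨T.image φ, by rw [Finset.card_image_of_injective _ hφ, hT1], ?_⟩
  simp only [Finset.mem_image]
  rintro _ ⟨x, hx, rfl⟩ _ ⟨y, hy, rfl⟩ hxy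
  have h1 := hT2 x hx y hy fun h => hxy (by rw [h])
  rw [not_le, abs_lt] at h1
  rw [hdist]
  constructor <;> linarith [h1.1, h1.2]

/-- With `ε = (1 - α²) / (1 + α²)` the squared distances in the code lie between `2n(1 - ε)` and
`2n(1 + ε)`, whose quotient is `α²`. -/
theorem isPreservableIn_of_sign_code {V : Type*} [Finite V] {α : ℝ} {G : SimpleGraph V} {n : ℕ}
    (hn : 0 < n) (hα0 : 0 ≤ α) (hα1 : α < 1)
    (hk : ((cliquePartitionCard G : ℝ) - 1) *
      (2 * Real.exp (-(((1 - α ^ 2) / (1 + α ^ 2)) ^ 2 * n / 2))) < 1) :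
    IsPreservableIn α G (EuclideanSpace ℝ (Fin n)) := by
  have h1 : 0 < 1 - α ^ 2 := by nlinarith
  obtain ⟨T, hT1, hT2⟩ := exists_sign_code (ε := (1 - α ^ 2) / (1 + α ^ 2)) (by positivity)
    ((div_le_one (by positivity)).2 (by nlinarith)) hk
  have hn' : (0 : ℝ) < n := by exact_mod_cast hn
  refine isPreservableIn_of_nearly_equidistant T hT1.ge
    (B := 2 * n * (1 + (1 - α ^ 2) / (1 + α ^ 2))) (by positivity) (le_of_eq ?_)
    fun x hx y hy hxy => ⟨(hT2 x hx y hy hxy).1.le, (hT2 x hx y hy hxy).2⟩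
  field_simp
  ring

/-! ### Points from subsets of constant size, and the bounds for `α < 1` -/

section Subsets
variable {d : ℕ}

/-- The indicator vector of `A`, projected to the hyperplane of vectors with coordinate sum zero. -/
noncomputable def centeredIndicator (A : Finset (Fin (d + 1))) : EuclideanSpace ℝ (Fin (d + 1)) :=
  WithLp.toLp 2 fun i => (if i ∈ A then 1 else 0) - (A.card : ℝ) / (d + 1)

theorem centeredIndicator_mem (A : Finset (Fin (d + 1))) :
    centeredIndicator A ∈
      (Submodule.span ℝ {(WithLp.toLp 2 fun _ => 1 : EuclideanSpace ℝ (Fin (d + 1)))})ᗮ := by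
  rw [Submodule.mem_orthogonal_singleton_iff_inner_left]
  simp only [centeredIndicator, PiLp.inner_apply, RCLike.inner_apply, conj_trivial, one_mul,
    Finset.sum_sub_distrib, Finset.sum_ite_mem, Finset.univ_inter, Finset.sum_const, nsmul_eq_mul,
    Finset.card_univ, Fintype.card_fin]
  push_cast
  field_simp
  ring

theorem dist_centeredIndicator_sq {A B : Finset (Fin (d + 1))} (h : A.card = B.card) :
    dist (centeredIndicator A) (centeredIndicator B) ^ 2 = 2 * ((A \ B).card : ℝ) := by
  have h1 : ∀ i : Fin (d + 1), ((if i ∈ A then (1 : ℝ) else 0) - (if i ∈ B then 1 else 0)) ^ 2 =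
      (if i ∈ A \ B then 1 else 0) + (if i ∈ B \ A then 1 else 0) := by
    intro i
    by_cases hA : i ∈ A <;> by_cases hB : i ∈ B <;> simp [hA, hB]
  rw [EuclideanSpace.dist_eq, Real.sq_sqrt (by positivity)]
  simp only [centeredIndicator, Real.dist_eq, sq_abs, h, sub_sub_sub_cancel_right, h1,
    Finset.sum_add_distrib, Finset.sum_ite_mem, Finset.univ_inter, Finset.sum_const, nsmul_eq_mul,
    mul_one]
  rw [Finset.card_sdiff_comm h.symm]
  ring

/-- The `w`-element subsets of a `(d + 1)`-element set give points of `ℓ₂ᵈ` whose squared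
distances lie between `2` and `2 * w`. -/
theorem isPreservableIn_of_le_choose {V : Type*} [Finite V] {α : ℝ} {G : SimpleGraph V} {w : ℕ}
    (hα : 0 < α) (hw : α ^ 2 * w < 1) (hp : cliquePartitionCard G ≤ (d + 1).choose w) :
    IsPreservableIn α G (EuclideanSpace ℝ (Fin d)) := by
  classical
  set e : EuclideanSpace ℝ (Fin (d + 1)) := WithLp.toLp 2 fun _ => 1 with he
  have he0 : e ≠ 0 := fun h => by
    have := congrArg (fun z => z (0 : Fin (d + 1))) h
    simp [he] at this
  have : Fact (finrank ℝ (EuclideanSpace ℝ (Fin (d + 1))) = d + 1) := ⟨finrank_euclideanSpace_fin⟩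
  have hfin : finrank ℝ (Submodule.span ℝ {e})ᗮ = d :=
    Submodule.finrank_orthogonal_span_singleton he0
  rw [← hfin]
  apply isPreservableIn_euclidean_finrank
  let φ : Finset (Fin (d + 1)) → (Submodule.span ℝ {e})ᗮ :=
    fun A => ⟨centeredIndicator A, centeredIndicator_mem A⟩
  have hd : ∀ A ∈ Finset.powersetCard w (Finset.univ : Finset (Fin (d + 1))),
      ∀ B ∈ Finset.powersetCard w (Finset.univ : Finset (Fin (d + 1))), A ≠ B →
      2 ≤ dist (φ A) (φ B) ^ 2 ∧ dist (φ A) (φ B) ^ 2 ≤ 2 * w := by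
    intro A hA B hB hAB
    rw [Finset.mem_powersetCard_univ] at hA hB
    have h1 : dist (φ A) (φ B) ^ 2 = 2 * ((A \ B).card : ℝ) :=
      dist_centeredIndicator_sq (hA.trans hB.symm)
    have h2 : 0 < (A \ B).card := by
      rw [Finset.card_pos, Finset.sdiff_nonempty]
      exact fun h => hAB (Finset.eq_of_subset_of_card_le h (by omega))
    have h3 : (A \ B).card ≤ w := hA ▸ Finset.card_le_card Finset.sdiff_subset
    have h2' : (1 : ℝ) ≤ (A \ B).card := by exact_mod_cast h2
    have h3' : ((A \ B).card : ℝ) ≤ w := by exact_mod_cast h3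
    rw [h1]
    constructor <;> linarith
  have hinj : Set.InjOn φ (Finset.powersetCard w (Finset.univ : Finset (Fin (d + 1)))) := by
    intro A hA B hB hAB
    by_contra hne
    have := (hd A hA B hB hne).1
    rw [hAB, dist_self] at this
    norm_num at this
  refine isPreservableIn_of_nearly_equidistant
    ((Finset.powersetCard w Finset.univ).image φ) ?_ (A := 2) (B := 2 / α ^ 2) (by positivity)
    (le_of_eq (by field_simp)) ?_
  · rwa [Finset.card_image_of_injOn hinj, Finset.card_powersetCard, Finset.card_univ,
      Fintype.card_fin]
  · simp only [Finset.mem_image]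
    rintro _ ⟨A, hA, rfl⟩ _ ⟨B, hB, rfl⟩ hAB
    obtain ⟨h1, h2⟩ := hd A hA B hB fun h => hAB (by rw [h])
    refine ⟨h1, h2.trans_lt ?_⟩
    rw [lt_div_iff₀ (by positivity)]
    nlinarith
end Subsets

theorem exp_natCast_div_le {a b : ℕ} (hb : b ≠ 0) {c : ℝ} (hc : 0 ≤ c)
    (h : (2.7182818286 : ℝ) ^ a ≤ c ^ b) : Real.exp (a / b) ≤ c := by
  refine le_of_pow_le_pow_left₀ hb hc (le_trans ?_ h)
  rw [← Real.exp_nat_mul]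
  have : (b : ℝ) * (a / b) = a * 1 := by field_simp
  rw [this, Real.exp_nat_mul]
  gcongr
  exact Real.exp_one_lt_d9.le

theorem le_of_succ_le_div_pow {p a b d m : ℕ} (hb : 0 < b) (h1 : (p : ℝ) + 1 ≤ (a / b) ^ d)
    (h2 : a ^ d < (m + 2) * b ^ d) : p ≤ m := by
  have hb' : (0 : ℝ) < b ^ d := by positivity
  rw [div_pow, le_div_iff₀ hb'] at h1
  have h3 : (p + 1) * b ^ d ≤ a ^ d := by exact_mod_cast h1
  have h4 : p + 1 < m + 2 := lt_of_mul_lt_mul_right (h3.trans_lt h2) (Nat.zero_le _)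
  omega

/-- For small `d`, sets of subsets of a suitable constant size beat the exponential bound on the
number of cliques; the size of the subsets depends on how close `α ^ 2` is to `1 / 2`. -/
theorem exists_choose_ge {p d : ℕ} {a : ℝ} (ha0 : 0 < a) (ha1 : a < 1 / 2) (hd : d ≤ 24)
    (hp : (p : ℝ) + 1 ≤ Real.exp ((1 - 2 * a) * d / 2)) :
    ∃ w : ℕ, a * w < 1 ∧ p ≤ (d + 1).choose w := by
  have key : ∀ (k l : ℕ) (c : ℝ), l ≠ 0 → (1 - 2 * a) / 2 ≤ (k : ℝ) / l → 0 ≤ c →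
      (2.7182818286 : ℝ) ^ k ≤ c ^ l → (p : ℝ) + 1 ≤ c ^ d := by
    intro k l c hl hkl hc hpow
    calc (p : ℝ) + 1 ≤ Real.exp (d * ((1 - 2 * a) / 2)) := by convert hp using 2; ring
      _ = Real.exp ((1 - 2 * a) / 2) ^ d := Real.exp_nat_mul _ _
      _ ≤ c ^ d := by
        gcongr
        exact (Real.exp_le_exp.2 hkl).trans (exp_natCast_div_le hl hc hpow)
  -- The fractions passed to `key` bound `exp ((1 - 2 * a) / 2)` on each range of `a`.
  rcases le_or_gt (27 / 100) a with h1 | h1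
  · have h := key 23 100 ((126 : ℕ) / (100 : ℕ)) (by norm_num) (by norm_num; linarith)
      (by norm_num) (by norm_num)
    refine ⟨2, by norm_num; linarith, le_of_succ_le_div_pow (by norm_num) h ?_⟩
    interval_cases d <;> norm_num [Nat.choose]
  rcases le_or_gt (19 / 100) a with h2 | h2
  · have h := key 31 100 ((1364 : ℕ) / (1000 : ℕ)) (by norm_num) (by norm_num; linarith)
      (by norm_num) (by norm_num)
    refine ⟨3, by norm_num; linarith, le_of_succ_le_div_pow (by norm_num) h ?_⟩
    interval_cases d <;> norm_num [Nat.choose]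
  rcases le_or_gt (1 / 10) a with h3 | h3
  · have h := key 2 5 ((1492 : ℕ) / (1000 : ℕ)) (by norm_num) (by norm_num; linarith)
      (by norm_num) (by norm_num)
    rcases le_or_gt d 4 with hd4 | hd4
    · refine ⟨2, by norm_num; linarith, le_of_succ_le_div_pow (by norm_num) h ?_⟩
      interval_cases d <;> norm_num [Nat.choose]
    · refine ⟨5, by norm_num; linarith, le_of_succ_le_div_pow (by norm_num) h ?_⟩
      interval_cases d <;> norm_num [Nat.choose]
  · have h := key 1 2 ((1649 : ℕ) / (1000 : ℕ)) (by norm_num) (by norm_num; linarith)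
      (by norm_num) (by norm_num)
    rcases le_or_gt d 4 with hd4 | hd4
    · refine ⟨2, by norm_num; linarith, le_of_succ_le_div_pow (by norm_num) h ?_⟩
      interval_cases d <;> norm_num [Nat.choose]
    rcases le_or_gt d 5 with hd5 | hd5
    · refine ⟨3, by norm_num; linarith, le_of_succ_le_div_pow (by norm_num) h ?_⟩
      obtain rfl : d = 5 := by omega
      norm_num [Nat.choose]
    rcases le_or_gt d 9 with hd9 | hd9
    · refine ⟨5, by norm_num; linarith, le_of_succ_le_div_pow (by norm_num) h ?_⟩
      interval_cases d <;> norm_num [Nat.choose]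
    · refine ⟨8, by norm_num; linarith, le_of_succ_le_div_pow (by norm_num) h ?_⟩
      interval_cases d <;> norm_num [Nat.choose]

/-- `3.8` is a rational upper bound for `2.2727 ^ (13 / 8)`. -/
theorem linear_mul_pow_le_five_pow {d : ℕ} (hd : 25 ≤ d) :
    10.62 * (13 / 8 * (d : ℝ)) * 3.8 ^ d + 1 ≤ 5 ^ d := by
  induction d, hd using Nat.le_induction with
  | base => norm_num
  | succ d hd ih =>
    have hd' : (25 : ℝ) ≤ d := by exact_mod_cast hd
    have h4 : (0 : ℝ) < 3.8 ^ d := by positivity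
    rw [pow_succ, pow_succ]
    push_cast
    nlinarith

/-- The covering of `isDoublingBound_of_random_cover` in dimension `⌊13 d / 8⌋` uses fewer balls than
the volumetric covering in dimension `d`. -/
theorem random_cover_card_le_five_pow {d : ℕ} (hd : 25 ≤ d) :
    10.62 * ((13 * d / 8 : ℕ) : ℝ) * 2.2727 ^ (13 * d / 8) + 1 ≤ 5 ^ d := by
  have h1 : (2.2727 : ℝ) ^ (13 * d / 8) ≤ 3.8 ^ d := by
    refine le_of_pow_le_pow_left₀ (n := 8) (by norm_num) (by positivity) ?_
    calc ((2.2727 : ℝ) ^ (13 * d / 8)) ^ 8 = 2.2727 ^ (13 * d / 8 * 8) := (pow_mul _ _ _).symm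
      _ ≤ 2.2727 ^ (13 * d) := pow_le_pow_right₀ (by norm_num) (Nat.div_mul_le_self _ _)
      _ = (2.2727 ^ 13) ^ d := pow_mul _ _ _
      _ ≤ (3.8 ^ 8) ^ d := by gcongr; norm_num
      _ = (3.8 ^ d) ^ 8 := by rw [← pow_mul, ← pow_mul, mul_comm]
  have h2 : ((13 * d / 8 : ℕ) : ℝ) ≤ 13 / 8 * d := by
    have : ((13 * d / 8 : ℕ) : ℝ) ≤ ((13 * d : ℕ) : ℝ) / (8 : ℕ) := Nat.cast_div_le
    push_cast at this
    linarith
  calc _ ≤ 10.62 * (13 / 8 * (d : ℝ)) * 3.8 ^ d + 1 := by gcongr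
    _ ≤ _ := linear_mul_pow_le_five_pow hd

/-- For `d ≥ 25` the dimension `n = ⌊13 d / 8⌋` is large enough for the sign code with the
correlation bound `ε = (1 - a) / (1 + a)`, where `a = α²`. The constant `1.3863` exceeds `2 log 2` and
pays for the two tails in Hoeffding's inequality. -/
theorem sign_code_exponent_le {a d n : ℝ} (ha0 : 0 < a) (ha1 : a < 1 / 2) (hd : 25 ≤ d)
    (hn : 13 / 8 * d - 7 / 8 ≤ n) :
    (1 - 2 * a) * d + 1.3863 ≤ ((1 - a) / (1 + a)) ^ 2 * n := by
  have h1 : 25 * (1 - 2 * a) * (1 + a) ^ 2 + 1.3863 * (1 + a) ^ 2 ≤ (1 - a) ^ 2 * 39.75 := by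
    -- the tangent to `a ^ 3` at `0.3`, close to where the difference of the two sides is smallest
    have : 3 * 0.3 ^ 2 * a - 2 * 0.3 ^ 3 ≤ a ^ 3 := by
      nlinarith [mul_nonneg (by linarith : 0 ≤ a + 0.6) (sq_nonneg (a - 0.3))]
    nlinarith [sq_nonneg (a - 0.3)]
  have h2 : (1 - 2 * a) * (1 + a) ^ 2 ≤ 13 / 8 * (1 - a) ^ 2 := by
    nlinarith [sq_nonneg (a - 0.3), mul_nonneg ha0.le (sq_nonneg (a - 0.3))]
  have h3 : ((1 - 2 * a) * d + 1.3863) * (1 + a) ^ 2 ≤ (1 - a) ^ 2 * n := by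
    nlinarith [mul_nonneg (sub_nonneg.2 hd) (sub_nonneg.2 h2),
      mul_nonneg (sq_nonneg (1 - a)) (sub_nonneg.2 hn)]
  rw [div_pow, div_mul_eq_mul_div, le_div_iff₀ (by positivity)]
  exact h3

/-- For large `d` the code lives in dimension `⌊13 d / 8⌋`, paid for by the sharper doubling bound; for
small `d` subsets of constant size give enough points in dimension `d` itself. -/
theorem preservationDimL2_le_of_lt_inv_sqrt_two {V : Type*} [Finite V] (G : SimpleGraph V) {α : ℝ}
    (h0 : 0 < α) (h1 : α < 1 / √2) :
    preservationDimL2 α G ≤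
      ((⌈Real.logb 2 5 *
        (⌈4 * Real.log ((cliquePartitionCard G : ℝ) + 1) / (2 - 4 * α ^ 2)⌉₊ : ℝ)⌉₊ : ℕ) : ℕ∞) := by
  set p := cliquePartitionCard G with hp
  set d := ⌈4 * Real.log ((p : ℝ) + 1) / (2 - 4 * α ^ 2)⌉₊ with hd
  have ha0 : 0 < α ^ 2 := by positivity
  have ha1 : α ^ 2 < 1 / 2 := by
    calc α ^ 2 < (1 / √2) ^ 2 := by gcongr
      _ = 1 / 2 := by rw [div_pow, Real.sq_sqrt (by norm_num), one_pow]
  have hpd : (p : ℝ) + 1 ≤ Real.exp ((1 - 2 * α ^ 2) * d / 2) := by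
    rw [← Real.log_le_iff_le_exp (by positivity)]
    have := Nat.le_ceil (4 * Real.log ((p : ℝ) + 1) / (2 - 4 * α ^ 2))
    rw [← hd, div_le_iff₀ (by linarith)] at this
    linarith
  rcases le_or_gt d 24 with hd24 | hd24
  · obtain ⟨w, hw, hpw⟩ := exists_choose_ge ha0 ha1 hd24 hpd
    exact preservationDimL2_le_ceil (isPreservableIn_of_le_choose h0 hw hpw) le_rfl
  · have hd25 : (25 : ℝ) ≤ d := by exact_mod_cast hd24
    set n := 13 * d / 8 with hn
    have hn0 : 0 < n := by omega
    have hn1 : 13 / 8 * (d : ℝ) - 7 / 8 ≤ n := by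
      have : 13 * d ≤ 8 * n + 7 := by omega
      have : (13 : ℝ) * d ≤ 8 * n + 7 := by exact_mod_cast this
      linarith
    have hexp := sign_code_exponent_le ha0 ha1 hd25 hn1
    refine preservationDimL2_le (n := n) (isPreservableIn_of_sign_code hn0 h0.le (by nlinarith) ?_)
      (isDoublingBound_of_random_cover
        ((random_cover_card_le_five_pow hd24).trans (five_pow_le_two_pow_ceil le_rfl)))
    have h2 : (2 : ℝ) ≤ Real.exp 0.69315 := by
      rw [← Real.log_le_iff_le_exp (by norm_num)]
      linarith [Real.log_two_lt_d9]
    calc ((p : ℝ) - 1) * (2 * Real.exp (-(((1 - α ^ 2) / (1 + α ^ 2)) ^ 2 * n / 2)))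
        < Real.exp ((1 - 2 * α ^ 2) * d / 2) *
          (2 * Real.exp (-(((1 - α ^ 2) / (1 + α ^ 2)) ^ 2 * n / 2))) :=
          mul_lt_mul_of_pos_right (by linarith) (by positivity)
      _ ≤ Real.exp ((1 - 2 * α ^ 2) * d / 2) *
          (Real.exp 0.69315 * Real.exp (-(((1 - α ^ 2) / (1 + α ^ 2)) ^ 2 * n / 2))) := by
          gcongr
      _ ≤ 1 := by
          rw [← Real.exp_add, ← Real.exp_add, Real.exp_le_one_iff]
          linarith

theorem preservationDimL2_le_of_lt_one {V : Type*} [Finite V] (G : SimpleGraph V) {α : ℝ}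
    (h0 : 0 < α) (h1 : α < 1) :
    preservationDimL2 α G ≤
      ((⌈Real.logb 2 5 *
        (⌈12 * ((1 + α ^ 2) / (1 - α ^ 2)) ^ 2 *
          Real.log (cliquePartitionCard G : ℝ)⌉₊ : ℝ)⌉₊ : ℕ) : ℕ∞) := by
  refine preservationDimL2_le_ceil ?_ le_rfl
  set p := cliquePartitionCard G with hp
  have h2 : 0 < 1 - α ^ 2 := by nlinarith
  rcases le_or_gt p 1 with hp1 | hp1
  · refine isPreservableIn_of_nearly_equidistant {0} (by simpa) (A := α ^ 2 * 1) one_pos le_rfl ?_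
    intro x hx y hy hxy
    exact absurd ((Finset.mem_singleton.1 hx).trans (Finset.mem_singleton.1 hy).symm) hxy
  · have hp2 : (2 : ℝ) ≤ p := by exact_mod_cast hp1
    have hlog : 0 < Real.log p := Real.log_pos (by linarith)
    have hpos : 0 < 12 * ((1 + α ^ 2) / (1 - α ^ 2)) ^ 2 * Real.log p := by positivity
    refine isPreservableIn_of_sign_code (Nat.ceil_pos.2 hpos) h0.le h1 ?_
    have hn := Nat.le_ceil (12 * ((1 + α ^ 2) / (1 - α ^ 2)) ^ 2 * Real.log p)
    set n := ⌈12 * ((1 + α ^ 2) / (1 - α ^ 2)) ^ 2 * Real.log p⌉₊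
    have h3 : 2 * Real.log p ≤ ((1 - α ^ 2) / (1 + α ^ 2)) ^ 2 * n / 2 := by
      have : ((1 - α ^ 2) / (1 + α ^ 2)) ^ 2 *
          (12 * ((1 + α ^ 2) / (1 - α ^ 2)) ^ 2 * Real.log p) = 12 * Real.log p := by field_simp
      have := mul_le_mul_of_nonneg_left hn (sq_nonneg ((1 - α ^ 2) / (1 + α ^ 2)))
      linarith
    have h4 : Real.exp (-(2 * Real.log p)) = ((p : ℝ) ^ 2)⁻¹ := by
      rw [Real.exp_neg, two_mul, Real.exp_add, Real.exp_log (by linarith), sq]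
    calc ((p : ℝ) - 1) * (2 * Real.exp (-(((1 - α ^ 2) / (1 + α ^ 2)) ^ 2 * n / 2)))
        ≤ ((p : ℝ) - 1) * (2 * Real.exp (-(2 * Real.log p))) := by
          gcongr
          linarith
      _ < 1 := by
          rw [h4, ← mul_assoc, ← div_eq_mul_inv, div_lt_one (by positivity)]
          nlinarith

/-! ### Moment generating functions of squared signed sums -/

section SignSums

/-- The signed sum `∑ ± a i` with the signs encoded by `s`. -/
noncomputable def signSum {n : ℕ} (a : Fin n → ℝ) (s : Fin n → Bool) : ℝ := ∑ i, boolSign (s i) * a i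

theorem sum_signSum_succ {n : ℕ} (a : Fin (n + 1) → ℝ) (f : ℝ → ℝ) :
    ∑ s : Fin (n + 1) → Bool, f (signSum a s) =
      ∑ s : Fin n → Bool, (f (signSum (Fin.tail a) s + a 0) + f (signSum (Fin.tail a) s - a 0)) := by
  rw [← (Fin.consEquiv fun _ => Bool).sum_comp, Fintype.sum_prod_type, Fintype.sum_bool,
    ← Finset.sum_add_distrib]
  refine Finset.sum_congr rfl fun s _ => ?_
  congr 2 <;>
  simp only [signSum, Fin.consEquiv_apply, Fin.sum_univ_succ, Fin.cons_zero, Fin.cons_succ,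
    boolSign, Fin.tail] <;> simp <;> ring

theorem sum_signSum_sq {n : ℕ} (a : Fin n → ℝ) :
    ∑ s : Fin n → Bool, signSum a s ^ 2 = 2 ^ n * ∑ i, a i ^ 2 := by
  induction n with
  | zero => simp [signSum]
  | succ n ih =>
    rw [sum_signSum_succ a (fun x => x ^ 2), Fin.sum_univ_succ]
    have h1 : ∀ s : Fin n → Bool, (signSum (Fin.tail a) s + a 0) ^ 2 +
        (signSum (Fin.tail a) s - a 0) ^ 2 = 2 * signSum (Fin.tail a) s ^ 2 + 2 * a 0 ^ 2 :=
      fun s => by ring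
    rw [Finset.sum_congr rfl fun s _ => h1 s, Finset.sum_add_distrib, ← Finset.mul_sum, ih]
    simp only [Finset.sum_const, Finset.card_univ, Fintype.card_fun, Fintype.card_bool,
      Fintype.card_fin, nsmul_eq_mul, Fin.tail]
    push_cast
    ring

theorem sum_signSum_pow_four_le {n : ℕ} (a : Fin n → ℝ) :
    ∑ s : Fin n → Bool, signSum a s ^ 4 ≤ 2 ^ n * (3 * (∑ i, a i ^ 2) ^ 2) := by
  induction n with
  | zero => simp [signSum]
  | succ n ih =>
    rw [sum_signSum_succ a (fun x => x ^ 4), Fin.sum_univ_succ]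
    have h1 : ∀ s : Fin n → Bool, (signSum (Fin.tail a) s + a 0) ^ 4 +
        (signSum (Fin.tail a) s - a 0) ^ 4 = 2 * signSum (Fin.tail a) s ^ 4 +
          12 * a 0 ^ 2 * signSum (Fin.tail a) s ^ 2 + 2 * a 0 ^ 4 := fun s => by ring
    rw [Finset.sum_congr rfl fun s _ => h1 s, Finset.sum_add_distrib, Finset.sum_add_distrib,
      ← Finset.mul_sum, ← Finset.mul_sum, sum_signSum_sq]
    have h2 := ih (Fin.tail a)
    simp only [Finset.sum_const, Finset.card_univ, Fintype.card_fun, Fintype.card_bool,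
      Fintype.card_fin, nsmul_eq_mul] at h2 ⊢
    have h3 : ∑ i : Fin n, a i.succ ^ 2 = ∑ i, Fin.tail a i ^ 2 := rfl
    rw [h3, pow_succ (2 : ℝ) n]
    have h4 : (0 : ℝ) ≤ 2 ^ n * a 0 ^ 4 := by positivity
    push_cast
    nlinarith

/-- The second and fourth moments bound the lower tail, by `exp (-y) ≤ 1 - y + y ^ 2 / 2`. -/
theorem sum_exp_neg_signSum_sq_le {n : ℕ} (a : Fin n → ℝ) {t : ℝ} (ht : 0 ≤ t) :
    ∑ s : Fin n → Bool, Real.exp (-t * signSum a s ^ 2) ≤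
      2 ^ n * Real.exp (-t * (∑ i, a i ^ 2) + 3 / 2 * t ^ 2 * (∑ i, a i ^ 2) ^ 2) := by
  set A := ∑ i, a i ^ 2 with hA
  have hexp : ∀ y : ℝ, 0 ≤ y → Real.exp (-y) ≤ 1 - y + y ^ 2 / 2 := fun y hy => by
    have h1 := Real.quadratic_le_exp_of_nonneg hy
    rw [Real.exp_neg, inv_le_iff_one_le_mul₀ (Real.exp_pos y)]
    have h2 : 0 < 1 - y + y ^ 2 / 2 := by nlinarith [sq_nonneg (y - 1)]
    nlinarith [mul_le_mul_of_nonneg_left h1 h2.le, pow_nonneg hy 4]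
  calc _ ≤ ∑ s : Fin n → Bool, (1 - t * signSum a s ^ 2 + t ^ 2 / 2 * signSum a s ^ 4) := by
        refine Finset.sum_le_sum fun s _ => ?_
        have := hexp (t * signSum a s ^ 2) (by positivity)
        rw [neg_mul]
        linarith
    _ ≤ 2 ^ n * (1 + (-t * A + 3 / 2 * t ^ 2 * A ^ 2)) := by
        rw [Finset.sum_add_distrib, Finset.sum_sub_distrib, ← Finset.mul_sum, ← Finset.mul_sum,
          sum_signSum_sq]
        simp only [Finset.sum_const, Finset.card_univ, Fintype.card_fun, Fintype.card_bool,
          Fintype.card_fin, nsmul_eq_mul]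
        have := mul_le_mul_of_nonneg_left (sum_signSum_pow_four_le a)
          (by positivity : 0 ≤ t ^ 2 / 2)
        push_cast
        rw [← hA] at *
        linarith
    _ ≤ _ := by
        gcongr
        linarith [Real.add_one_le_exp (-t * A + 3 / 2 * t ^ 2 * A ^ 2)]

/-- Shifting the signed sum by `w` makes the Gaussian bound on the moment generating function of
its square amenable to induction on the number of summands. -/
theorem sum_exp_shift_signSum_sq_le {n : ℕ} (a : Fin n → ℝ) {t : ℝ} (ht : 0 ≤ t)
    (hA : 2 * t * ∑ i, a i ^ 2 < 1) (w : ℝ) :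
    ∑ s : Fin n → Bool, Real.exp (t * (w + signSum a s) ^ 2) ≤
      2 ^ n * (Real.exp (t * w ^ 2 / (1 - 2 * t * ∑ i, a i ^ 2)) /
        √(1 - 2 * t * ∑ i, a i ^ 2)) := by
  induction n generalizing w with
  | zero => simp [signSum]
  | succ n ih =>
    rw [Fin.sum_univ_succ] at hA ⊢
    have h3 : ∑ i : Fin n, a i.succ ^ 2 = ∑ i, Fin.tail a i ^ 2 := rfl
    rw [h3] at hA ⊢
    set A' := ∑ i, Fin.tail a i ^ 2 with hA'
    have hta : 0 ≤ t * a 0 ^ 2 := by positivity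
    set D' := 1 - 2 * t * A' with hD'
    have hD : 0 < 1 - 2 * t * (a 0 ^ 2 + A') := by linarith
    have hD'0 : 0 < D' := by nlinarith
    have ih' := fun w => ih (Fin.tail a) (by linarith) w
    rw [sum_signSum_succ a (fun x => Real.exp (t * (w + x) ^ 2)), Finset.sum_add_distrib]
    have e1 : ∀ s : Fin n → Bool, w + (signSum (Fin.tail a) s + a 0) =
        (w + a 0) + signSum (Fin.tail a) s := fun s => by ring
    have e2 : ∀ s : Fin n → Bool, w + (signSum (Fin.tail a) s - a 0) =
        (w - a 0) + signSum (Fin.tail a) s := fun s => by ring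
    simp only [e1, e2]
    refine (add_le_add (ih' (w + a 0)) (ih' (w - a 0))).trans ?_
    set T := t / D' with hT
    have hT0 : 0 ≤ T := by positivity
    set y := 2 * T * a 0 ^ 2 with hy
    have hDy : 1 - 2 * t * (a 0 ^ 2 + A') = D' * (1 - y) := by
      rw [hy, hT]; field_simp; rw [hD']; ring
    have hy0 : 0 ≤ y := by positivity
    have hy1 : 0 < 1 - y := by
      rw [hDy] at hD
      exact pos_of_mul_pos_right hD hD'0.le
    have hcosh : Real.exp (t * (w + a 0) ^ 2 / D') + Real.exp (t * (w - a 0) ^ 2 / D') ≤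
        2 * Real.exp (T * w ^ 2 * (1 + y) + y / 2) := by
      have h1 : Real.exp (t * (w + a 0) ^ 2 / D') + Real.exp (t * (w - a 0) ^ 2 / D') =
          2 * (Real.exp (T * w ^ 2 + y / 2) * Real.cosh (2 * T * w * a 0)) := by
        have e3 : t * (w + a 0) ^ 2 / D' = T * w ^ 2 + y / 2 + 2 * T * w * a 0 := by
          rw [hy, hT]; ring
        have e4 : t * (w - a 0) ^ 2 / D' = T * w ^ 2 + y / 2 + -(2 * T * w * a 0) := by
          rw [hy, hT]; ring
        rw [e3, e4, Real.exp_add, Real.exp_add _ (-(2 * T * w * a 0)), Real.cosh_eq]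
        ring
      rw [h1]
      have h2 : T * w ^ 2 * (1 + y) + y / 2 = (T * w ^ 2 + y / 2) + (2 * T * w * a 0) ^ 2 / 2 := by
        rw [hy]; ring
      rw [h2, Real.exp_add (T * w ^ 2 + y / 2)]
      gcongr
      exact Real.cosh_le_exp_half_sq _
    have h5 : Real.exp (y / 2) ≤ 1 / √(1 - y) := by
      rw [le_div_iff₀ (Real.sqrt_pos.2 hy1)]
      have h6 : √(1 - y) ≤ Real.exp (-(y / 2)) := by
        rw [Real.sqrt_le_left (Real.exp_pos _).le, ← Real.exp_nat_mul]
        have := Real.one_sub_le_exp_neg y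
        convert this using 2
        push_cast; ring
      calc _ ≤ Real.exp (y / 2) * Real.exp (-(y / 2)) := by gcongr
        _ = 1 := by rw [← Real.exp_add]; simp
    have h6 : T * w ^ 2 * (1 + y) ≤ t * w ^ 2 / (D' * (1 - y)) := by
      have : t * w ^ 2 / (D' * (1 - y)) = T * w ^ 2 / (1 - y) := by rw [hT]; field_simp
      rw [this, le_div_iff₀ hy1]
      have : 0 ≤ T * w ^ 2 := by positivity
      nlinarith [mul_nonneg this (sq_nonneg y)]
    rw [hDy, Real.sqrt_mul hD'0.le, pow_succ (2 : ℝ) n]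
    calc 2 ^ n * (Real.exp (t * (w + a 0) ^ 2 / D') / √D') +
          2 ^ n * (Real.exp (t * (w - a 0) ^ 2 / D') / √D')
        = 2 ^ n * ((Real.exp (t * (w + a 0) ^ 2 / D') + Real.exp (t * (w - a 0) ^ 2 / D')) / √D') :=
          by ring
      _ ≤ 2 ^ n * (2 * (Real.exp (t * w ^ 2 / (D' * (1 - y))) * (1 / √(1 - y))) / √D') := by
          gcongr
          refine hcosh.trans ?_
          rw [Real.exp_add]
          gcongr
      _ = _ := by field_simp

/-- Up to the factor `2 ^ n`, the moment generating function of the squared signed sum is at most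
`1 / √(1 - y) ≤ exp ((y + y ^ 2) / 2)` with `y = 2 * t * ∑ i, a i ^ 2 ≤ 1 / 2`. -/
theorem sum_exp_signSum_sq_le {n : ℕ} (a : Fin n → ℝ) {t : ℝ} (ht : 0 ≤ t)
    (hA : 4 * t * ∑ i, a i ^ 2 ≤ 1) :
    ∑ s : Fin n → Bool, Real.exp (t * signSum a s ^ 2) ≤
      2 ^ n * Real.exp (t * (∑ i, a i ^ 2) + 2 * t ^ 2 * (∑ i, a i ^ 2) ^ 2) := by
  have h1 := sum_exp_shift_signSum_sq_le a ht (by linarith) 0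
  simp only [zero_add, ne_eq, OfNat.ofNat_ne_zero, not_false_eq_true, zero_pow, mul_zero, zero_div,
    Real.exp_zero] at h1
  refine h1.trans ?_
  gcongr
  have hA0 : 0 ≤ ∑ i, a i ^ 2 := by positivity
  set A := ∑ i, a i ^ 2
  have hy0 : 0 ≤ 2 * t * A := by positivity
  obtain ⟨y, hy⟩ : ∃ y, y = 2 * t * A := ⟨_, rfl⟩
  have hy1 : y ≤ 1 / 2 := by linarith
  rw [← hy] at hy0 ⊢
  have e1 : t * A + 2 * t ^ 2 * A ^ 2 = (y + y ^ 2) / 2 := by rw [hy]; ring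
  rw [e1, div_le_iff₀ (Real.sqrt_pos.2 (by linarith)), ← abs_of_pos (Real.exp_pos _),
    ← Real.sqrt_sq_eq_abs, ← Real.sqrt_mul (by positivity), ← Real.exp_nat_mul]
  apply Real.le_sqrt_of_sq_le
  have e2 : ((2 : ℕ) : ℝ) * ((y + y ^ 2) / 2) = y + y ^ 2 := by push_cast; ring
  rw [e2]
  have h2 := Real.quadratic_le_exp_of_nonneg (by positivity : 0 ≤ y + y ^ 2)
  have h3 := mul_le_mul_of_nonneg_right h2 (by linarith : 0 ≤ 1 - y)
  refine le_trans ?_ h3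
  have h4 : 0 ≤ y ^ 2 * ((1 - y) * (1 + y) ^ 2 / 2 - y) := by
    apply mul_nonneg (sq_nonneg y)
    nlinarith [mul_nonneg hy0 (by linarith : 0 ≤ 1 / 2 - y), mul_nonneg hy0 hy0]
  nlinarith

/-- Chernoff's bound for `m` independent uniform samples from a finite type. -/
theorem card_sum_ge_mul_exp_le {Ω : Type*} [Fintype Ω] (m : ℕ) (F : Ω → ℝ) (K β : ℝ)
    (hF : ∑ s, Real.exp (F s) ≤ Fintype.card Ω * Real.exp β) :
    ((Finset.univ.filter fun S : Fin m → Ω => K ≤ ∑ k, F (S k)).card : ℝ) ≤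
      Fintype.card (Fin m → Ω) * Real.exp (m * β - K) := by
  set B := Finset.univ.filter fun S : Fin m → Ω => K ≤ ∑ k, F (S k) with hB
  have h1 : (B.card : ℝ) * Real.exp K ≤ (∑ s, Real.exp (F s)) ^ m := by
    calc (B.card : ℝ) * Real.exp K = ∑ S ∈ B, Real.exp K := by
          rw [Finset.sum_const, nsmul_eq_mul]
      _ ≤ ∑ S ∈ B, Real.exp (∑ k, F (S k)) := Finset.sum_le_sum fun S hS =>
          Real.exp_le_exp.2 (Finset.mem_filter.1 hS).2
      _ ≤ ∑ S : Fin m → Ω, Real.exp (∑ k, F (S k)) :=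
          Finset.sum_le_sum_of_subset_of_nonneg (Finset.subset_univ B)
            fun _ _ _ => (Real.exp_pos _).le
      _ = (∑ s, Real.exp (F s)) ^ m := by
          simp only [Real.exp_sum]
          rw [sum_prod_eq_prod_sum fun (_ : Fin m) s => Real.exp (F s), Finset.prod_const,
            Finset.card_univ, Fintype.card_fin]
  have h2 : (∑ s, Real.exp (F s)) ^ m ≤ (Fintype.card Ω * Real.exp β) ^ m :=
    pow_le_pow_left₀ (Finset.sum_nonneg fun _ _ => (Real.exp_pos _).le) hF m
  rw [Real.exp_sub, Real.exp_nat_mul, Fintype.card_fun, Fintype.card_fin, ← mul_div_assoc,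
    le_div_iff₀ (Real.exp_pos K)]
  push_cast
  rw [← mul_pow]
  exact h1.trans h2

end SignSums

/-! ### The adjacency spectrum and Gram placements -/

section Spectral
variable {W : Type*} [Fintype W]

open Classical in
theorem hasEigenvalue_toLin'_iff_mem_spectrum {M : Matrix W W ℝ} {μ : ℝ} :
    Module.End.HasEigenvalue (Matrix.toLin' M) μ ↔ μ ∈ spectrum ℝ M := by
  rw [Module.End.hasEigenvalue_iff_mem_spectrum, Matrix.spectrum_toLin']

open Classical in
theorem le_maxAdjEigenvalue {H : SimpleGraph W} {μ : ℝ}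
    (h : Module.End.HasEigenvalue (Matrix.toLin' (H.adjMatrix ℝ)) μ) : μ ≤ maxAdjEigenvalue H := by
  refine le_csSup (Set.Finite.bddAbove ?_) h
  simp only [hasEigenvalue_toLin'_iff_mem_spectrum]
  exact Matrix.finite_real_spectrum

open Classical in
theorem posSemidef_maxAdjEigenvalue_sub (H : SimpleGraph W) :
    (algebraMap ℝ (Matrix W W ℝ) (maxAdjEigenvalue H) - H.adjMatrix ℝ).PosSemidef := by
  rw [Matrix.posSemidef_iff_isHermitian_and_spectrum_nonneg]
  constructor
  · refine Matrix.IsHermitian.sub ?_ ?_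
    · rw [Matrix.algebraMap_eq_diagonal]
      exact Matrix.isHermitian_diagonal _
    · rw [Matrix.IsHermitian, Matrix.conjTranspose_eq_transpose_of_trivial]
      exact H.transpose_adjMatrix
  · intro μ hμ
    rw [← spectrum.singleton_sub_eq, Set.singleton_sub] at hμ
    obtain ⟨ν, hν, rfl⟩ := hμ
    have := le_maxAdjEigenvalue (hasEigenvalue_toLin'_iff_mem_spectrum.2 hν)
    simpa using this

open Classical in
theorem sum_adj_mul_le (H : SimpleGraph W) (x : W → ℝ) :
    ∑ u, ∑ v, (if H.Adj u v then x u * x v else 0) ≤ maxAdjEigenvalue H * ∑ u, x u ^ 2 := by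
  have h := (posSemidef_maxAdjEigenvalue_sub H).dotProduct_mulVec_nonneg x
  rw [Matrix.sub_mulVec, dotProduct_sub, sub_nonneg, Algebra.algebraMap_eq_smul_one,
    Matrix.smul_mulVec, Matrix.one_mulVec, dotProduct_smul, smul_eq_mul] at h
  simpa only [dotProduct, star_trivial, Matrix.mulVec, SimpleGraph.adjMatrix_apply, ite_mul,
    one_mul, zero_mul, Finset.mul_sum, mul_ite, mul_zero, sq] using h

/-- Since the adjacency matrix has nonnegative entries, `|xᵀ A x| ≤ |x|ᵀ A |x|`, so no eigenvalue
is below `-λ`, where `λ` is the largest one. -/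
theorem neg_le_sum_adj_mul (H : SimpleGraph W) [DecidableRel H.Adj] (x : W → ℝ) :
    -(maxAdjEigenvalue H * ∑ u, x u ^ 2) ≤ ∑ u, ∑ v, (if H.Adj u v then x u * x v else 0) := by
  have h := sum_adj_mul_le H fun u => |x u|
  simp only [sq_abs] at h
  rw [neg_le]
  refine le_trans ?_ h
  rw [← Finset.sum_neg_distrib]
  refine Finset.sum_le_sum fun u _ => ?_
  rw [← Finset.sum_neg_distrib]
  refine Finset.sum_le_sum fun v _ => ?_
  split_ifs
  · rw [← abs_mul]; exact neg_le_abs _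
  · simp

open Classical Matrix MatrixOrder in
/-- Vectors with Gram matrix `1 + λ⁻¹ A`, which is positive semidefinite. -/
theorem exists_gram_one_add_adjMatrix (H : SimpleGraph W) (hl : 0 < maxAdjEigenvalue H) :
    ∃ z : W → EuclideanSpace ℝ W, ∀ u v, inner ℝ (z u) (z v) =
      (if u = v then 1 else 0) + (maxAdjEigenvalue H)⁻¹ * (if H.Adj u v then 1 else 0) := by
  set l := maxAdjEigenvalue H with hldef
  have hM : ((1 : Matrix W W ℝ) + l⁻¹ • H.adjMatrix ℝ).PosSemidef := by
    refine .of_dotProduct_mulVec_nonneg ?_ fun x => ?_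
    · rw [Matrix.IsHermitian, Matrix.conjTranspose_eq_transpose_of_trivial, Matrix.transpose_add,
        Matrix.transpose_smul, Matrix.transpose_one, H.transpose_adjMatrix]
    · have h := neg_le_sum_adj_mul H x
      have h2 : star x ⬝ᵥ ((1 : Matrix W W ℝ) + l⁻¹ • H.adjMatrix ℝ) *ᵥ x =
          ∑ u, x u ^ 2 + l⁻¹ * ∑ u, ∑ v, (if H.Adj u v then x u * x v else 0) := by
        rw [Matrix.add_mulVec, Matrix.one_mulVec, dotProduct_add, Matrix.smul_mulVec,
          dotProduct_smul, smul_eq_mul]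
        simp only [dotProduct, Matrix.mulVec, star_trivial, SimpleGraph.adjMatrix_apply, ite_mul,
          one_mul, zero_mul, Finset.mul_sum, mul_ite, mul_zero, sq]
      rw [h2]
      have h3 := mul_le_mul_of_nonneg_left h (inv_pos.2 hl).le
      have h4 : l⁻¹ * -(l * ∑ u, x u ^ 2) = -∑ u, x u ^ 2 := by field_simp
      rw [h4] at h3
      linarith
  obtain ⟨B, hB⟩ := CStarAlgebra.nonneg_iff_eq_star_mul_self.mp hM.nonneg
  refine ⟨fun u => WithLp.toLp 2 fun w => B w u, fun u v => ?_⟩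
  have := congrFun (congrFun hB u) v
  rw [Matrix.add_apply, Matrix.smul_apply, Matrix.one_apply, SimpleGraph.adjMatrix_apply,
    smul_eq_mul] at this
  rw [this, Matrix.star_eq_conjTranspose, Matrix.mul_apply]
  simp only [PiLp.inner_apply, RCLike.inner_apply, conj_trivial, Matrix.conjTranspose_apply,
    star_trivial]
  exact Finset.sum_congr rfl fun w _ => mul_comm _ _

/-- Distances in the Gram placement: nonadjacent vertices are at distance `√2`, and adjacent ones
at distance `√(2 - 2 / λ)`. -/
theorem exists_dist_sq_eq (H : SimpleGraph W) (hl : 0 < maxAdjEigenvalue H) :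
    ∃ z : W → EuclideanSpace ℝ W, ∀ u v, u ≠ v →
      (H.Adj u v → dist (z u) (z v) ^ 2 = 2 - 2 / maxAdjEigenvalue H) ∧
      (¬ H.Adj u v → dist (z u) (z v) ^ 2 = 2) := by
  obtain ⟨z, hz⟩ := exists_gram_one_add_adjMatrix H hl
  refine ⟨z, fun u v huv => ?_⟩
  have h1 : dist (z u) (z v) ^ 2 = 2 - 2 * inner ℝ (z u) (z v) := by
    rw [dist_eq_norm, norm_sub_sq_real, ← real_inner_self_eq_norm_sq, ← real_inner_self_eq_norm_sq,
      hz u u, hz v v]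
    simp
    ring
  rw [h1, hz]
  constructor <;> intro h <;> simp [h, huv]
  ring

end Spectral

/-! ### The quotient graph and random projections -/

section Quotient
variable {V : Type*} {G : SimpleGraph V}

theorem nbhdQuotient_mk_eq_iff {u v : V} :
    Quotient.mk (nbhdSetoid G) u = Quotient.mk (nbhdSetoid G) v ↔
      closedNeighborhood G u = closedNeighborhood G v := Quotient.eq

theorem adj_of_closedNeighborhood_eq {u v : V}
    (h : closedNeighborhood G u = closedNeighborhood G v) (huv : u ≠ v) : G.Adj u v := by
  have h1 : u ∈ closedNeighborhood G v := h ▸ (Or.inr rfl : u ∈ closedNeighborhood G u)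
  exact h1.resolve_right huv

theorem adj_left_congr {u u' v : V} (h : closedNeighborhood G u = closedNeighborhood G u')
    (hv : v ≠ u') (huv : G.Adj u v) : G.Adj u' v := by
  have h1 : v ∈ closedNeighborhood G u' := h ▸ (Or.inl huv.symm : v ∈ closedNeighborhood G u)
  exact (h1.resolve_right hv).symm

/-- Adjacency of distinct classes does not depend on the representatives. -/
theorem nbhdQuotient_adj_mk_iff {u v : V}
    (huv : Quotient.mk (nbhdSetoid G) u ≠ Quotient.mk (nbhdSetoid G) v) :
    (nbhdQuotient G).Adj (Quotient.mk _ u) (Quotient.mk _ v) ↔ G.Adj u v := by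
  constructor
  · rintro ⟨-, u', v', hu', hv', h⟩
    have h1 : v' ≠ u := fun h => huv (by rw [← h, hv'])
    have h2 : G.Adj u v' := adj_left_congr (nbhdQuotient_mk_eq_iff.1 hu') h1 h
    have h3 : u ≠ v := fun h => huv (by rw [h])
    exact (adj_left_congr (nbhdQuotient_mk_eq_iff.1 hv') h3 h2.symm).symm
  · exact fun h => ⟨huv, u, v, rfl, rfl, h⟩

/-- Vertices with the same closed neighborhood are adjacent, so they may share a point. -/
theorem isPreservableIn_of_nbhdQuotient {X : Type*} [MetricSpace X] {α : ℝ}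
    (h : IsPreservableIn α (nbhdQuotient G) X) : IsPreservableIn α G X := by
  rw [isPreservableIn_iff] at h ⊢
  obtain ⟨x, r, hr, h⟩ := h
  refine ⟨fun u => x (Quotient.mk _ u), r, hr, fun u v huv => ?_⟩
  by_cases hq : Quotient.mk (nbhdSetoid G) u = Quotient.mk (nbhdSetoid G) v
  · refine ⟨fun _ => by simpa only [hq, dist_self] using hr, fun hn => ?_⟩
    exact absurd (adj_of_closedNeighborhood_eq (nbhdQuotient_mk_eq_iff.1 hq) huv) hn
  · rw [← nbhdQuotient_adj_mk_iff hq]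
    exact h _ _ hq
end Quotient

section Spectral
variable {W : Type*} [Fintype W] {H : SimpleGraph W} {α : ℝ}

/-- The case `1 ≤ e` is excluded because there `√(1 - e) = 0` and `1 / 0 = 0 < α`. -/
theorem sq_mul_lt_one_of_lt_inv_sqrt {e : ℝ} (h1 : 1 ≤ α) (h2 : α < 1 / √(1 - e)) :
    e < 1 ∧ α ^ 2 * (1 - e) < 1 := by
  have he : e < 1 := by
    by_contra! he
    rw [Real.sqrt_eq_zero_of_nonpos (by linarith), div_zero] at h2
    linarith
  refine ⟨he, ?_⟩
  have h3 : 0 < √(1 - e) := Real.sqrt_pos.2 (by linarith)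
  rw [lt_div_iff₀ h3] at h2
  calc α ^ 2 * (1 - e) = (α * √(1 - e)) ^ 2 := by rw [mul_pow, Real.sq_sqrt (by linarith)]
    _ < 1 := by
      have : 0 ≤ α * √(1 - e) := by positivity
      nlinarith

open Classical in
theorem nonempty_of_maxAdjEigenvalue_pos (hl : 0 < maxAdjEigenvalue H) : Nonempty W := by
  by_contra hW
  rw [not_nonempty_iff] at hW
  have h : {μ : ℝ | Module.End.HasEigenvalue (Matrix.toLin' (H.adjMatrix ℝ)) μ} = ∅ := by
    rw [Set.eq_empty_iff_forall_notMem]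
    intro μ hμ
    obtain ⟨v, hv⟩ := Module.End.HasEigenvalue.exists_hasEigenvector hμ
    exact hv.2 (Subsingleton.elim _ _)
  rw [maxAdjEigenvalue, h, Real.sSup_empty] at hl
  exact lt_irrefl _ hl

/-- The Gram placement, moved into the span of its differences. With `r² = 2 (1 - 1 / (4 λ))` the squared
distances `2 - 2 / λ` are below `r²`, and `2` is at least `α² r²`. -/
theorem isPreservableIn_card_sub_one (hl : 0 < maxAdjEigenvalue H) (h1 : 1 ≤ α)
    (h2 : α < 1 / √(1 - 1 / (4 * maxAdjEigenvalue H))) :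
    ∃ k : ℕ, (k : ℝ) ≤ (Nat.card W : ℝ) - 1 ∧ IsPreservableIn α H (EuclideanSpace ℝ (Fin k)) := by
  obtain ⟨z, hz⟩ := exists_dist_sq_eq H hl
  set l := maxAdjEigenvalue H with hldef
  obtain ⟨he, hα⟩ := sq_mul_lt_one_of_lt_inv_sqrt h1 h2
  obtain ⟨o⟩ := nonempty_of_maxAdjEigenvalue_pos hl
  have hcard : Fintype.card W = (Fintype.card W - 1) + 1 := by
    have := Fintype.card_pos_iff.2 ⟨o⟩
    omega
  refine ⟨finrank ℝ (vectorSpan ℝ (Set.range z)), ?_, ?_⟩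
  · have h3 := finrank_vectorSpan_range_le ℝ z hcard
    rw [Nat.card_eq_fintype_card, hcard]
    push_cast
    simpa using h3
  · apply isPreservableIn_euclidean_finrank
    rw [isPreservableIn_iff]
    have hr : 0 < 2 * (1 - 1 / (4 * l)) := by linarith
    refine ⟨fun u => ⟨z u - z o, vsub_mem_vectorSpan ℝ (Set.mem_range_self u)
      (Set.mem_range_self o)⟩, √(2 * (1 - 1 / (4 * l))), Real.sqrt_pos.2 hr, fun u v huv => ?_⟩
    rw [Subtype.dist_eq, dist_sub_right]
    obtain ⟨h3, h4⟩ := hz u v huv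
    constructor
    · intro h
      apply Real.lt_sqrt_of_sq_lt
      rw [h3 h]
      have : 0 < l⁻¹ := inv_pos.2 hl
      have e1 : 1 / (4 * l) = l⁻¹ / 4 := by field_simp
      rw [e1, div_eq_mul_inv]
      linarith
    · intro h
      refine abs_le_of_sq_le_sq' ?_ dist_nonneg |>.2
      rw [mul_pow, Real.sq_sqrt hr.le, h4 h]
      linarith

/-- The linear map `ℓ₂ⁿ → ℓ₂ᵐ` whose `k`-th coordinate is the inner product with the sign vector
`S k`. It is not normalized: for random signs the squared norm grows by a factor of about `m`. -/
noncomputable def signProjection {n m : ℕ} (S : Fin m → Fin n → Bool)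
    (x : EuclideanSpace ℝ (Fin n)) : EuclideanSpace ℝ (Fin m) :=
  WithLp.toLp 2 fun k => signSum (fun i => x i) (S k)

theorem dist_signProjection_sq {n m : ℕ} (S : Fin m → Fin n → Bool)
    (x y : EuclideanSpace ℝ (Fin n)) :
    dist (signProjection S x) (signProjection S y) ^ 2 =
      ∑ k, signSum (fun i => x i - y i) (S k) ^ 2 := by
  rw [EuclideanSpace.dist_eq, Real.sq_sqrt (by positivity)]
  simp only [signProjection, Real.dist_eq, sq_abs, signSum, ← Finset.sum_sub_distrib, mul_sub]

theorem sum_sub_sq_eq_dist_sq {n : ℕ} (x y : EuclideanSpace ℝ (Fin n)) :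
    ∑ i, (x i - y i) ^ 2 = dist x y ^ 2 := by
  rw [EuclideanSpace.dist_eq, Real.sq_sqrt (by positivity)]
  simp only [Real.dist_eq, sq_abs]

/-- Nonadjacent pairs of the Gram placement are rarely contracted much. -/
theorem card_signProjection_le {n m : ℕ} {x y : EuclideanSpace ℝ (Fin n)} {e : ℝ} (he : 0 ≤ e)
    (h : dist x y ^ 2 = 2) :
    ((Finset.univ.filter fun S : Fin m → Fin n → Bool =>
      dist (signProjection S x) (signProjection S y) ^ 2 ≤ 2 * m * (1 - e)).card : ℝ) ≤
      Fintype.card (Fin m → Fin n → Bool) * Real.exp (-(m * e ^ 2 / 6)) := by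
  have h1 := sum_exp_neg_signSum_sq_le (fun i => x i - y i) (t := e / 6) (by positivity)
  rw [sum_sub_sq_eq_dist_sq, h] at h1
  have h2 := card_sum_ge_mul_exp_le m (fun s => -(e / 6) * signSum (fun i => x i - y i) s ^ 2)
    (-(e / 6) * (2 * m * (1 - e))) _ (by
      rw [Fintype.card_fun, Fintype.card_bool, Fintype.card_fin]; push_cast; exact h1)
  refine le_trans ?_ (h2.trans (le_of_eq ?_))
  · rw [Nat.cast_le]
    refine Finset.card_le_card fun S hS => ?_
    simp only [Finset.mem_filter, Finset.mem_univ, true_and] at hS ⊢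
    rw [dist_signProjection_sq] at hS
    rw [← Finset.mul_sum]
    exact mul_le_mul_of_nonpos_left hS (by linarith)
  · congr 2
    ring

/-- Adjacent pairs of the Gram placement are rarely stretched much; here `e = 1 / (4 λ)`, so that
`2 - 8 * e = 2 - 2 / λ`. -/
theorem card_signProjection_ge {n m : ℕ} {x y : EuclideanSpace ℝ (Fin n)} {e : ℝ} (he : 0 ≤ e)
    (h : dist x y ^ 2 = 2 - 8 * e) :
    ((Finset.univ.filter fun S : Fin m → Fin n → Bool =>
      2 * m * (1 - e) ^ 2 ≤ dist (signProjection S x) (signProjection S y) ^ 2).card : ℝ) ≤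
      Fintype.card (Fin m → Fin n → Bool) * Real.exp (-(m * e ^ 2 / 6)) := by
  have he4 : 0 ≤ 2 - 8 * e := h ▸ sq_nonneg _
  have h1 := sum_exp_signSum_sq_le (fun i => x i - y i) (t := e / 4) (by positivity) (by
    rw [sum_sub_sq_eq_dist_sq, h]; nlinarith)
  rw [sum_sub_sq_eq_dist_sq, h] at h1
  have h2 := card_sum_ge_mul_exp_le m (fun s => e / 4 * signSum (fun i => x i - y i) s ^ 2)
    (e / 4 * (2 * m * (1 - e) ^ 2)) _ (by
      rw [Fintype.card_fun, Fintype.card_bool, Fintype.card_fin]; push_cast; exact h1)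
  refine le_trans ?_ (h2.trans ?_)
  · rw [Nat.cast_le]
    refine Finset.card_le_card fun S hS => ?_
    simp only [Finset.mem_filter, Finset.mem_univ, true_and] at hS ⊢
    rw [dist_signProjection_sq] at hS
    rw [← Finset.mul_sum]
    exact mul_le_mul_of_nonneg_left hS (by linarith)
  · gcongr
    have h3 : e / 4 * (2 - 8 * e) + 2 * (e / 4) ^ 2 * (2 - 8 * e) ^ 2 - e / 4 * (2 * (1 - e) ^ 2) ≤
        -(e ^ 2 / 6) := by
      have h4 : (2 - 8 * e) ^ 2 ≤ 4 := by nlinarith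
      have h5 := mul_le_mul_of_nonneg_left h4 (by positivity : 0 ≤ 2 * (e / 4) ^ 2)
      have h6 : 0 ≤ e ^ 3 := by positivity
      nlinarith
    have h7 := mul_le_mul_of_nonneg_left h3 (Nat.cast_nonneg (α := ℝ) m)
    linarith

/-- A random sign projection of the Gram placement separates adjacent from nonadjacent pairs. With
`e = 1 / (4 λ)`, each pair fails with probability at most `exp (-m e² / 6) ≤ |W|⁻²`, so a union bound
over the ordered pairs of distinct vertices applies. -/
theorem isPreservableIn_of_log_card_le (hl : 0 < maxAdjEigenvalue H) (h1 : 1 ≤ α)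
    (h2 : α < 1 / √(1 - 1 / (4 * maxAdjEigenvalue H))) {m : ℕ}
    (hm : 192 * maxAdjEigenvalue H ^ 2 * Real.log (Nat.card W) ≤ m) :
    IsPreservableIn α H (EuclideanSpace ℝ (Fin m)) := by
  classical
  obtain ⟨z', hz'⟩ := exists_dist_sq_eq H hl
  set l := maxAdjEigenvalue H with hldef
  obtain ⟨he, hα⟩ := sq_mul_lt_one_of_lt_inv_sqrt h1 h2
  obtain ⟨e, hel⟩ : ∃ e, e = 1 / (4 * l) := ⟨_, rfl⟩
  rw [← hel] at he hα
  have he0 : 0 < e := by rw [hel]; positivity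
  let z : W → EuclideanSpace ℝ (Fin (finrank ℝ (EuclideanSpace ℝ W))) :=
    fun u => (stdOrthonormalBasis ℝ (EuclideanSpace ℝ W)).repr (z' u)
  have hz : ∀ u v, u ≠ v → (H.Adj u v → dist (z u) (z v) ^ 2 = 2 - 8 * e) ∧
      (¬ H.Adj u v → dist (z u) (z v) ^ 2 = 2) := by
    intro u v huv
    simp only [z, LinearIsometryEquiv.dist_map]
    refine ⟨fun h => ?_, (hz' u v huv).2⟩
    rw [(hz' u v huv).1 h, hel]
    field_simp
    ring
  -- `m = 0` leaves at most one vertex; otherwise the radius `√(2 m) (1 - e)` used below is positive.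
  rcases Nat.eq_zero_or_pos m with rfl | hm0
  · rcases subsingleton_or_nontrivial W with hW | hW
    · rw [isPreservableIn_iff]
      exact ⟨fun _ => 0, 1, one_pos, fun u v huv => absurd (Subsingleton.elim u v) huv⟩
    · have h3 : 0 < Real.log (Nat.card W) :=
        Real.log_pos (by exact_mod_cast Finite.one_lt_card)
      have h4 : 0 < 192 * l ^ 2 * Real.log (Nat.card W) := by positivity
      simp only [Nat.cast_zero] at hm
      linarith
  let Ω := Fin m → Fin (finrank ℝ (EuclideanSpace ℝ W)) → Bool
  let bad : W × W → Finset Ω := fun q =>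
    if H.Adj q.1 q.2 then Finset.univ.filter fun S : Ω =>
      2 * m * (1 - e) ^ 2 ≤ dist (signProjection S (z q.1)) (signProjection S (z q.2)) ^ 2
    else Finset.univ.filter fun S : Ω =>
      dist (signProjection S (z q.1)) (signProjection S (z q.2)) ^ 2 ≤ 2 * m * (1 - e)
  have hbad : ∀ q ∈ (Finset.univ : Finset W).offDiag,
      ((bad q).card : ℝ) ≤ Fintype.card Ω * Real.exp (-(m * e ^ 2 / 6)) := by
    intro q hq
    have hne : q.1 ≠ q.2 := (Finset.mem_offDiag.1 hq).2.2
    simp only [bad]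
    split_ifs with h
    · exact card_signProjection_ge he0.le ((hz _ _ hne).1 h)
    · exact card_signProjection_le he0.le ((hz _ _ hne).2 h)
  have hΩ : (0 : ℝ) < Fintype.card Ω := by exact_mod_cast Fintype.card_pos
  have hlt : (((Finset.univ : Finset W).offDiag.biUnion bad).card : ℝ) <
      (Finset.univ : Finset Ω).card := by
    rcases isEmpty_or_nonempty W with hW | hW
    · simpa using hΩ
    have hc : (0 : ℝ) < Fintype.card W := by exact_mod_cast Fintype.card_pos
    have hexp : Real.exp (-(m * e ^ 2 / 6)) ≤ ((Fintype.card W : ℝ) ^ 2)⁻¹ := by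
      rw [Nat.card_eq_fintype_card] at hm
      have h3 : 2 * Real.log (Fintype.card W) ≤ m * e ^ 2 / 6 := by
        have h4 := mul_le_mul_of_nonneg_right hm (sq_nonneg e)
        have h5 : 192 * l ^ 2 * Real.log (Fintype.card W) * e ^ 2 =
            12 * Real.log (Fintype.card W) := by
          rw [hel]; field_simp; ring
        linarith
      calc _ ≤ Real.exp (-(2 * Real.log (Fintype.card W))) := by gcongr
        _ = _ := by rw [Real.exp_neg, two_mul, Real.exp_add, Real.exp_log hc, sq]
    calc _ ≤ ((∑ q ∈ (Finset.univ : Finset W).offDiag, (bad q).card : ℕ) : ℝ) := by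
          exact_mod_cast Finset.card_biUnion_le
      _ ≤ ∑ q ∈ (Finset.univ : Finset W).offDiag,
          (Fintype.card Ω * ((Fintype.card W : ℝ) ^ 2)⁻¹) := by
        push_cast
        exact Finset.sum_le_sum fun q hq => (hbad q hq).trans (by gcongr)
      _ = (Fintype.card W * Fintype.card W - Fintype.card W) *
          (Fintype.card Ω * ((Fintype.card W : ℝ) ^ 2)⁻¹) := by
        rw [Finset.sum_const, nsmul_eq_mul, Finset.offDiag_card, Finset.card_univ,
          Nat.cast_sub (Nat.le_mul_self _)]
        push_cast; rfl
      _ < Fintype.card Ω := by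
        rw [← mul_assoc, ← div_eq_mul_inv, div_lt_iff₀ (by positivity)]
        nlinarith [mul_pos hc hΩ]
      _ = _ := by rw [Finset.card_univ]
  obtain ⟨S, -, hS⟩ := Finset.exists_mem_notMem_of_card_lt_card (by exact_mod_cast hlt)
  have hm' : (0 : ℝ) < m := by exact_mod_cast hm0
  have hr : 0 < 2 * (m : ℝ) * (1 - e) ^ 2 := by
    have : 0 < 1 - e := by linarith
    positivity
  rw [isPreservableIn_iff]
  refine ⟨fun u => signProjection S (z u), √(2 * m * (1 - e) ^ 2), Real.sqrt_pos.2 hr,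
    fun u v huv => ?_⟩
  have hSuv : S ∉ bad (u, v) := fun h => hS (Finset.mem_biUnion.2 ⟨(u, v), by simp [huv], h⟩)
  simp only [bad] at hSuv
  constructor
  · intro h
    rw [if_pos h] at hSuv
    simp only [Finset.mem_filter, Finset.mem_univ, true_and, not_le] at hSuv
    exact Real.lt_sqrt_of_sq_lt hSuv
  · intro h
    rw [if_neg h] at hSuv
    simp only [Finset.mem_filter, Finset.mem_univ, true_and, not_le] at hSuv
    refine abs_le_of_sq_le_sq' ?_ dist_nonneg |>.2
    rw [mul_pow, Real.sq_sqrt hr.le]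
    refine le_trans ?_ hSuv.le
    have h3 : 0 ≤ 2 * (m : ℝ) * (1 - e) := by
      have : 0 < 1 - e := by linarith
      positivity
    nlinarith
end Spectral

open Classical in
/-- The minimum in the bound is attained either by the random projection or by the Gram placement. -/
theorem preservationDimL2_le_of_lambdaG {V : Type*} [Fintype V] (G : SimpleGraph V) {α : ℝ}
    (hl : 0 < lambdaG G) (h1 : 1 ≤ α) (h2 : α < 1 / √(1 - 1 / (4 * lambdaG G))) :
    preservationDimL2 α G ≤
      ((⌈Real.logb 2 5 *
        min (⌈192 * lambdaG G ^ 2 * Real.log (Nat.card (NbhdPartition G) : ℝ)⌉₊ : ℝ)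
          ((Nat.card (NbhdPartition G) : ℝ) - 1)⌉₊ : ℕ) : ℕ∞) := by
  rcases min_choice (⌈192 * lambdaG G ^ 2 * Real.log (Nat.card (NbhdPartition G) : ℝ)⌉₊ : ℝ)
      ((Nat.card (NbhdPartition G) : ℝ) - 1) with h | h
  · rw [h]
    exact preservationDimL2_le_ceil
      (isPreservableIn_of_nbhdQuotient (isPreservableIn_of_log_card_le hl h1 h2 (Nat.le_ceil _)))
      le_rfl
  · rw [h]
    obtain ⟨k, hk, hG⟩ := isPreservableIn_card_sub_one hl h1 h2
    exact preservationDimL2_le_ceil (isPreservableIn_of_nbhdQuotient hG) hk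

/-! ### The complete bipartite graph -/

section Bipartite

open Classical in
theorem maxAdjEigenvalue_eq_of_bipartite {W : Type*} [Fintype W] {H : SimpleGraph W}
    {T₀ T₁ : Finset W} {m : ℕ} (hT : Disjoint T₀ T₁) (h0 : T₀.card = m) (h1 : T₁.card = m)
    (hm : 0 < m) (hadj : ∀ a b, H.Adj a b ↔ (a ∈ T₀ ∧ b ∈ T₁) ∨ (a ∈ T₁ ∧ b ∈ T₀)) :
    maxAdjEigenvalue H = m := by
  have hd0 : ∀ a ∈ T₀, H.neighborFinset a = T₁ := by
    intro a ha
    ext b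
    have : a ∉ T₁ := Finset.disjoint_left.1 hT ha
    simp [SimpleGraph.mem_neighborFinset, hadj, ha, this]
  have hd1 : ∀ a ∈ T₁, H.neighborFinset a = T₀ := by
    intro a ha
    ext b
    have : a ∉ T₀ := Finset.disjoint_right.1 hT ha
    simp [SimpleGraph.mem_neighborFinset, hadj, ha, this]
  have hd : ∀ a, a ∉ T₀ → a ∉ T₁ → H.neighborFinset a = ∅ := by
    intro a ha0 ha1
    ext b
    simp [SimpleGraph.mem_neighborFinset, hadj, ha0, ha1]
  apply le_antisymm
  · refine Real.sSup_le (fun μ hμ => ?_) m.cast_nonneg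
    obtain ⟨k, hk⟩ := eigenvalue_mem_ball hμ
    rw [mem_closedBall, Real.dist_eq, SimpleGraph.adjMatrix_apply, if_neg (H.irrefl), sub_zero] at hk
    refine (le_abs_self μ).trans (hk.trans ?_)
    calc ∑ j ∈ Finset.univ.erase k, ‖H.adjMatrix ℝ k j‖ ≤ ∑ j, ‖H.adjMatrix ℝ k j‖ :=
          Finset.sum_le_sum_of_subset_of_nonneg (Finset.erase_subset _ _)
            fun _ _ _ => norm_nonneg _
      _ = ((H.neighborFinset k).card : ℝ) := by
          rw [SimpleGraph.neighborFinset_eq_filter, Finset.card_filter]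
          push_cast
          refine Finset.sum_congr rfl fun j _ => ?_
          rw [SimpleGraph.adjMatrix_apply]
          split_ifs <;> simp
      _ ≤ m := by
          by_cases hk0 : k ∈ T₀
          · rw [hd0 k hk0, h1]
          by_cases hk1 : k ∈ T₁
          · rw [hd1 k hk1, h0]
          · rw [hd k hk0 hk1]; simp
  · apply le_maxAdjEigenvalue
    -- the indicator vector of the non-isolated vertices is an eigenvector
    refine Module.End.hasEigenvalue_of_hasEigenvector (x := fun a => if a ∈ T₀ ∪ T₁ then 1 else 0)
      ⟨?_, ?_⟩
    · rw [Module.End.mem_eigenspace_iff, Matrix.toLin'_apply]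
      funext a
      rw [SimpleGraph.adjMatrix_mulVec_apply, Pi.smul_apply, smul_eq_mul]
      by_cases ha0 : a ∈ T₀
      · rw [hd0 a ha0, Finset.sum_congr rfl fun b hb => if_pos (Finset.mem_union_right _ hb)]
        simp [ha0, h1]
      by_cases ha1 : a ∈ T₁
      · rw [hd1 a ha1, Finset.sum_congr rfl fun b hb => if_pos (Finset.mem_union_left _ hb)]
        simp [ha1, h0]
      · rw [hd a ha0 ha1]
        simp [ha0, ha1]
    · obtain ⟨a, ha⟩ := Finset.card_pos.1 (h0 ▸ hm)
      intro h
      have := congrFun h a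
      simp [ha] at this

variable {V : Type*}

theorem sum_sum_dist_sq {E : Type*} [NormedAddCommGroup E] [InnerProductSpace ℝ E] (x : V → E)
    (S T : Finset V) :
    ∑ u ∈ S, ∑ v ∈ T, dist (x u) (x v) ^ 2 =
      T.card * ∑ u ∈ S, ‖x u‖ ^ 2 + S.card * ∑ v ∈ T, ‖x v‖ ^ 2 -
        2 * inner ℝ (∑ u ∈ S, x u) (∑ v ∈ T, x v) := by
  simp only [dist_eq_norm, norm_sub_sq_real, Finset.sum_add_distrib, Finset.sum_sub_distrib,
    Finset.sum_const, nsmul_eq_mul, sum_inner, inner_sum, Finset.mul_sum]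
  rw [Finset.sum_comm (s := T)]
  ring

/-- The negative-type inequality: for two families of equally many points, the squared distances
within the families are dominated by those across them. -/
theorem sum_dist_sq_within_le {E : Type*} [NormedAddCommGroup E] [InnerProductSpace ℝ E]
    (x : V → E) {S T : Finset V} (h : S.card = T.card) :
    ∑ u ∈ S, ∑ v ∈ S, dist (x u) (x v) ^ 2 + ∑ u ∈ T, ∑ v ∈ T, dist (x u) (x v) ^ 2 ≤
      2 * ∑ u ∈ S, ∑ v ∈ T, dist (x u) (x v) ^ 2 := by
  have h1 := norm_sub_sq_real (∑ u ∈ S, x u) (∑ v ∈ T, x v)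
  have h2 := sq_nonneg ‖(∑ u ∈ S, x u) - ∑ v ∈ T, x v‖
  rw [sum_sum_dist_sq, sum_sum_dist_sq, sum_sum_dist_sq, real_inner_self_eq_norm_sq,
    real_inner_self_eq_norm_sq, h]
  linarith

theorem le_sum_sum_dist_sq {X : Type*} [MetricSpace X] (x : V → X) {S : Finset V} {B : ℝ}
    (hB : ∀ u ∈ S, ∀ v ∈ S, u ≠ v → B ≤ dist (x u) (x v) ^ 2) :
    (S.card : ℝ) * ((S.card - 1) * B) ≤ ∑ u ∈ S, ∑ v ∈ S, dist (x u) (x v) ^ 2 := by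
  classical
  rw [← nsmul_eq_mul, ← Finset.sum_const]
  refine Finset.sum_le_sum fun u hu => ?_
  rw [← Finset.add_sum_erase S _ hu, dist_self]
  have h1 : ((S.erase u).card : ℝ) = S.card - 1 := by
    rw [Finset.card_erase_of_mem hu, Nat.cast_sub (Finset.card_pos.2 ⟨u, hu⟩), Nat.cast_one]
  rw [← h1, ← nsmul_eq_mul, ← Finset.sum_const]
  have h2 : ∑ v ∈ S.erase u, B ≤ ∑ v ∈ S.erase u, dist (x u) (x v) ^ 2 :=
    Finset.sum_le_sum fun v hv =>
      hB u hu v (Finset.mem_of_mem_erase hv) (Finset.ne_of_mem_erase hv).symm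
  linarith

theorem not_isPreservableIn_of_bipartite {E : Type*} [NormedAddCommGroup E]
    [InnerProductSpace ℝ E] {G : SimpleGraph V} {S₀ S₁ : Finset V} {m : ℕ}
    (hS : Disjoint S₀ S₁) (h0 : S₀.card = m) (h1 : S₁.card = m) (hm : 2 ≤ m)
    (hadj : ∀ u v, G.Adj u v ↔ (u ∈ S₀ ∧ v ∈ S₁) ∨ (u ∈ S₁ ∧ v ∈ S₀)) {α : ℝ}
    (hα : 1 / √(1 - 1 / (m : ℝ)) < α) : ¬ IsPreservableIn α G E := by
  rw [isPreservableIn_iff]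
  rintro ⟨x, r, hr, h⟩
  have hm' : (2 : ℝ) ≤ m := by exact_mod_cast hm
  have hα0 : 0 < α := lt_of_le_of_lt (by positivity) hα
  have hα2 : (m : ℝ) < α ^ 2 * (m - 1) := by
    have h2 : 0 < 1 - 1 / (m : ℝ) := by
      rw [sub_pos, div_lt_one (by linarith)]; linarith
    have h3 : 1 < α * √(1 - 1 / (m : ℝ)) := by rwa [div_lt_iff₀ (Real.sqrt_pos.2 h2)] at hα
    have h4 : 1 < (α * √(1 - 1 / (m : ℝ))) ^ 2 := by nlinarith
    rw [mul_pow, Real.sq_sqrt h2.le] at h4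
    have h5 : α ^ 2 * (1 - 1 / (m : ℝ)) * m = α ^ 2 * (m - 1) := by field_simp
    nlinarith
  have hfar : ∀ S : Finset V, (∀ u ∈ S, ∀ v ∈ S, ¬ G.Adj u v) → ∀ u ∈ S, ∀ v ∈ S, u ≠ v →
      (α * r) ^ 2 ≤ dist (x u) (x v) ^ 2 := fun S hind u hu v hv huv =>
    pow_le_pow_left₀ (by positivity) ((h u v huv).2 (hind u hu v hv)) 2
  have hind0 : ∀ u ∈ S₀, ∀ v ∈ S₀, ¬ G.Adj u v := fun u hu v hv => by
    have := Finset.disjoint_left.1 hS hu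
    have := Finset.disjoint_left.1 hS hv
    rw [hadj]; tauto
  have hind1 : ∀ u ∈ S₁, ∀ v ∈ S₁, ¬ G.Adj u v := fun u hu v hv => by
    have := Finset.disjoint_right.1 hS hu
    have := Finset.disjoint_right.1 hS hv
    rw [hadj]; tauto
  have e0 := le_sum_sum_dist_sq x (hfar S₀ hind0)
  have e1 := le_sum_sum_dist_sq x (hfar S₁ hind1)
  have e2 := sum_dist_sq_within_le x (h0.trans h1.symm)
  have e3 : ∑ u ∈ S₀, ∑ v ∈ S₁, dist (x u) (x v) ^ 2 ≤ ∑ u ∈ S₀, ∑ v ∈ S₁, r ^ 2 := by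
    refine Finset.sum_le_sum fun u hu => Finset.sum_le_sum fun v hv => ?_
    have huv : G.Adj u v := (hadj u v).2 (Or.inl ⟨hu, hv⟩)
    exact pow_le_pow_left₀ dist_nonneg ((h u v huv.ne).1 huv).le 2
  simp only [Finset.sum_const, nsmul_eq_mul, h0, h1] at e0 e1 e3
  have h6 : (m : ℝ) * ((m - 1) * (α * r) ^ 2) ≤ m * (m * r ^ 2) := by linarith
  have h7 : (m : ℝ) * (m * r ^ 2) < m * ((m - 1) * (α * r) ^ 2) := by
    have h8 : (m : ℝ) * r ^ 2 < α ^ 2 * (m - 1) * r ^ 2 := by gcongr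
    have h9 : ((m : ℝ) - 1) * (α * r) ^ 2 = α ^ 2 * (m - 1) * r ^ 2 := by ring
    rw [h9]
    gcongr
  linarith

/-- A vertex of the same part as `u`, other than `u`, is adjacent to all vertices of the other part but
not to `u`. -/
theorem closedNeighborhood_injective_of_bipartite {G : SimpleGraph V} {S₀ S₁ : Finset V}
    (hS : Disjoint S₀ S₁) (h0 : 2 ≤ S₀.card) (h1 : 2 ≤ S₁.card)
    (hadj : ∀ u v, G.Adj u v ↔ (u ∈ S₀ ∧ v ∈ S₁) ∨ (u ∈ S₁ ∧ v ∈ S₀)) :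
    Function.Injective (closedNeighborhood G) := by
  intro u v h
  by_contra huv
  have hcase : ∀ (A B : Finset V), Disjoint A B → 2 ≤ A.card →
      (∀ a b, G.Adj a b ↔ (a ∈ A ∧ b ∈ B) ∨ (a ∈ B ∧ b ∈ A)) → u ∈ A → v ∈ B → False := by
    intro A B hAB hA hadj hu hv
    obtain ⟨w, hw, hwu⟩ := Finset.exists_mem_ne (by omega : 1 < A.card) u
    have h2 : w ∈ closedNeighborhood G u := h ▸ Or.inl ((hadj w v).2 (Or.inl ⟨hw, hv⟩))
    have h3 := (hadj w u).1 (h2.resolve_right hwu)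
    have h4 := Finset.disjoint_left.1 hAB hu
    have h5 := Finset.disjoint_left.1 hAB hw
    tauto
  rcases (hadj u v).1 (adj_of_closedNeighborhood_eq h huv) with ⟨hu, hv⟩ | ⟨hu, hv⟩
  · exact hcase S₀ S₁ hS h0 hadj hu hv
  · exact hcase S₁ S₀ hS.symm h1 (fun a b => by rw [hadj, or_comm]) hu hv

theorem lambdaG_eq_of_bipartite [Fintype V] {G : SimpleGraph V} {S₀ S₁ : Finset V} {m : ℕ}
    (hS : Disjoint S₀ S₁) (h0 : S₀.card = m) (h1 : S₁.card = m) (hm : 2 ≤ m)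
    (hadj : ∀ u v, G.Adj u v ↔ (u ∈ S₀ ∧ v ∈ S₁) ∨ (u ∈ S₁ ∧ v ∈ S₀)) :
    lambdaG G = m := by
  classical
  have hinj : Function.Injective (Quotient.mk (nbhdSetoid G)) := fun u v huv =>
    closedNeighborhood_injective_of_bipartite hS (h0 ▸ hm) (h1 ▸ hm) hadj
      (nbhdQuotient_mk_eq_iff.1 huv)
  refine maxAdjEigenvalue_eq_of_bipartite (T₀ := S₀.image (Quotient.mk (nbhdSetoid G)))
    (T₁ := S₁.image (Quotient.mk (nbhdSetoid G))) ((Finset.disjoint_image hinj).2 hS)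
    (by rw [Finset.card_image_of_injective _ hinj, h0])
    (by rw [Finset.card_image_of_injective _ hinj, h1]) (by omega) fun a b => ?_
  obtain ⟨u, rfl⟩ := Quotient.exists_rep a
  obtain ⟨v, rfl⟩ := Quotient.exists_rep b
  simp only [hinj.mem_finset_image]
  rw [← hadj]
  by_cases huv : u = v
  · subst huv
    simp
  · exact nbhdQuotient_adj_mk_iff fun h => huv (hinj h)

/-- The complete bipartite graph between `S₀` and `S₁`, with all other vertices isolated. -/
def bipartiteGraph (S₀ S₁ : Finset V) (hS : Disjoint S₀ S₁) : SimpleGraph V where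
  Adj u v := (u ∈ S₀ ∧ v ∈ S₁) ∨ (u ∈ S₁ ∧ v ∈ S₀)
  symm := ⟨fun _ _ h => h.elim (fun h => Or.inr ⟨h.2, h.1⟩) fun h => Or.inl ⟨h.2, h.1⟩⟩
  loopless := ⟨fun _ h => h.elim (fun h => Finset.disjoint_left.1 hS h.1 h.2)
    fun h => Finset.disjoint_left.1 hS h.2 h.1⟩

theorem exists_not_isPreservableIn [Fintype V] (hV : 4 ≤ Fintype.card V) :
    ∃ (G : SimpleGraph V) (S₀ S₁ : Finset V),
      Disjoint S₀ S₁ ∧ S₀.card = Fintype.card V / 2 ∧ S₁.card = Fintype.card V / 2 ∧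
      (∀ u v : V, G.Adj u v ↔ (u ∈ S₀ ∧ v ∈ S₁) ∨ (u ∈ S₁ ∧ v ∈ S₀)) ∧
      1 < lambdaG G ∧
      ∀ α : ℝ, 1 / √(1 - 1 / lambdaG G) < α →
        (∀ d : ℕ, ¬ IsPreservableIn α G (EuclideanSpace ℝ (Fin d))) ∧
        ¬ IsPreservableIn α G (lp (fun _ : ℕ => ℝ) 2) := by
  classical
  set m := Fintype.card V / 2 with hmdef
  have hm : 2 ≤ m := by omega
  obtain ⟨S₀, -, h0⟩ := Finset.exists_subset_card_eq (s := (Finset.univ : Finset V)) (n := m)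
    (by rw [Finset.card_univ]; omega)
  obtain ⟨S₁, hsub, h1⟩ := Finset.exists_subset_card_eq (s := S₀ᶜ) (n := m)
    (by rw [Finset.card_compl]; omega)
  have hS : Disjoint S₀ S₁ := Finset.disjoint_of_subset_right hsub disjoint_compl_right
  have hadj : ∀ u v, (bipartiteGraph S₀ S₁ hS).Adj u v ↔
      (u ∈ S₀ ∧ v ∈ S₁) ∨ (u ∈ S₁ ∧ v ∈ S₀) := fun _ _ => Iff.rfl
  have hl := lambdaG_eq_of_bipartite hS h0 h1 hm hadj
  refine ⟨bipartiteGraph S₀ S₁ hS, S₀, S₁, hS, h0, h1, hadj, ?_, fun α hα => ?_⟩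
  · rw [hl]
    exact_mod_cast (by omega : 1 < m)
  · rw [hl] at hα
    exact ⟨fun d => not_isPreservableIn_of_bipartite hS h0 h1 hm hadj hα,
      not_isPreservableIn_of_bipartite hS h0 h1 hm hadj hα⟩

end Bipartite

theorem mainTheorem5 {V : Type*} [Fintype V] :
    (∀ (G : SimpleGraph V) (α : ℝ),
      (0 < α → α < 1 / √2 →
        preservationDimL2 α G ≤
          ((⌈Real.logb 2 5 *
            (⌈4 * Real.log ((cliquePartitionCard G : ℝ) + 1) / (2 - 4 * α ^ 2)⌉₊ : ℝ)⌉₊ : ℕ) :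
            ℕ∞)) ∧
      (1 / √3 < α → α < 1 →
        preservationDimL2 α G ≤
          ((⌈Real.logb 2 5 *
            (⌈12 * ((1 + α ^ 2) / (1 - α ^ 2)) ^ 2 *
              Real.log (cliquePartitionCard G : ℝ)⌉₊ : ℝ)⌉₊ : ℕ) : ℕ∞)) ∧
      (0 < lambdaG G → 1 ≤ α → α < 1 / √(1 - 1 / (4 * lambdaG G)) →
        preservationDimL2 α G ≤
          ((⌈Real.logb 2 5 *
            min (⌈192 * lambdaG G ^ 2 * Real.log (Nat.card (NbhdPartition G) : ℝ)⌉₊ : ℝ)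
              ((Nat.card (NbhdPartition G) : ℝ) - 1)⌉₊ : ℕ) : ℕ∞))) ∧
    (4 ≤ Fintype.card V →
      ∃ (G : SimpleGraph V) (S₀ S₁ : Finset V),
        Disjoint S₀ S₁ ∧ S₀.card = Fintype.card V / 2 ∧ S₁.card = Fintype.card V / 2 ∧
        (∀ u v : V, G.Adj u v ↔ (u ∈ S₀ ∧ v ∈ S₁) ∨ (u ∈ S₁ ∧ v ∈ S₀)) ∧
        1 < lambdaG G ∧
        ∀ α : ℝ, 1 / √(1 - 1 / lambdaG G) < α →
          (∀ d : ℕ, ¬ IsPreservableIn α G (EuclideanSpace ℝ (Fin d))) ∧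
          ¬ IsPreservableIn α G (lp (fun _ : ℕ => ℝ) 2)) := by
  refine ⟨fun G α => ⟨preservationDimL2_le_of_lt_inv_sqrt_two G, fun h0 h1 => ?_,
    preservationDimL2_le_of_lambdaG G⟩, exists_not_isPreservableIn⟩
  exact preservationDimL2_le_of_lt_one G (lt_trans (by positivity) h0) h1
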